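/- Let $(X,\langle\cdot,\cdot\rangle,\|\cdot\|)$ be a separable real Hilbert space and let $A:D(A)\subset X\to X$ be a densely defined, self-adjoint operator with $\langle Ax,x\rangle\ge 0$ for all $x\in D(A)$ and such that $(\lambda I+A)^{-1}:X\to X$ is compact for some $\lambda>0$. Let $\{\varphi_k\}_{k\ge1}$ be an orthonormal basis of $X$ with $A\varphi_k=\lambda_k\varphi_k$ and $0\le\lambda_1\le\lambda_2\le\cdots$. Put $e^{-tA}x=\sum_k e^{-\lambda_kt}\langle x,\varphi_k\rangle\varphi_k$, $$D(A^{1/2})=\Big\{x\in X:\sum_k\lambda_k|\langle x,\varphi_k\rangle|^2<\infty\Big\},\qquad A^{1/2}x=\sum_k\lambda_k^{1/2}\langle x,\varphi_k\rangle\varphi_k,$$ $\langle x,y\rangle_{1/2}=\langle x,y\rangle+\langle A^{1/2}x,A^{1/2}y\rangle$ and $\|x\|_{1/2}=(\|x\|^2+\|A^{1/2}x\|^2)^{1/2}$. Let $B:D(B)\subset X\to X$ be a linear operator with $D(A^{1/2})\subset D(B)$ and $\|Bx\|\le C_B\|x\|_{1/2}$ for all $x\in D(A^{1/2})$, for some constant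 $C_B>0$. For $y_0\in X$ and $p\in L^2(0,T)$ let $y(t;y_0,p)=e^{-tA}y_0-\int_0^te^{-(t-s)A}p(s)B\varphi_1\,ds$ be the mild solution of $y'+Ay+p(t)B\varphi_1=0$, $y(0)=y_0$. Assume that $\{A,B\}$ is $1$-null controllable in every time $T>0$, that is, for every $T>0$ there is $N_T>0$ such that for every $y_0\in X$ there is $p\in L^2(0,T)$ with $\|p\|_{L^2(0,T)}\le N_T\|y_0\|$ and $y(T;y_0,p)=0$. Assume also that there are $\nu,T_0>0$ such that the control cost $$N(\tau)=\sup_{\|y_0\|=1}\inf\{\|p\|_{L^2(0,\tau)}:y(\tau;y_0,p)=0\}$$ satisfies $N(\tau)\le e^{\nu/\tau}$ for all $0<\tau\le T_0$. Then there exists $r_1>0$ such that for every $R>0$, with $$T_R:=1+\frac1\kappa\,\max\Big\{0,\log\frac{R^2}{r_1^2}\Big\}>0,\qquad \kappa:=\min\{\lambda_2,\,2(\lambda_2-\lambda_1)\},$$ the following holds: for every $u_0\in D(A^{1/2})$ with $$|\langle u_0,\varphi_1\rangle_{1/2}-1|<r_1\quad\text{and}\quad\|u_0-\langle u_0,\varphi_1\rangle_{1/2}\,\varphi_1\|_{1/2}\le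 R,$$ the problem $u'(t)+Au(t)+p(t)Bu(t)=0$, $u(0)=u_0$, is exactly controllable to the ground state solution $\psi_1(t)=e^{-\lambda_1t}\varphi_1$ in time $T_R$: there is a control $p\in L^2(0,T_R)$ whose mild solution $u\in C([0,T_R];D(A^{1/2}))$, i.e. $u(t)=e^{-tA}u_0-\int_0^te^{-(t-s)A}p(s)Bu(s)\,ds$ on $[0,T_R]$, satisfies $u(T_R)=\psi_1(T_R)$. (When $\lambda_2\ge2\lambda_1$, in particular when $\lambda_1=0$, one has $\kappa=\lambda_2$.) -/

import Mathlib

open MeasureTheory Set Filter Topology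
open scoped ENNReal InnerProductSpace

noncomputable section

namespace ParabolicControl

variable {X : Type*} [NormedAddCommGroup X] [InnerProductSpace ℝ X] [CompleteSpace X]

/-- `(μ I + A)⁻¹ : X → X` exists, is bounded and is compact for some `μ > 0`. -/
def HasCompactResolvent (A : X →ₗ.[ℝ] X) : Prop :=
  ∃ μ : ℝ, 0 < μ ∧ ∃ J : X →L[ℝ] X, IsCompactOperator J ∧
    (∀ x : X, ∃ h : J x ∈ A.domain, μ • J x + A ⟨J x, h⟩ = x) ∧
    (∀ x : A.domain, J (μ • (x : X) + A x) = x)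

/-- The standing assumptions on `A`: densely defined, self-adjoint, accretive, with compact
resolvent. -/
structure IsAdmissible (A : X →ₗ.[ℝ] X) : Prop where
  dense_domain : Dense (A.domain : Set X)
  selfAdjoint : IsSelfAdjoint A
  accretive : ∀ x : A.domain, 0 ≤ ⟪A x, (x : X)⟫_ℝ
  compactResolvent : HasCompactResolvent A

/-- `φ` is an orthonormal basis of eigenvectors of `A`, and `lam` is the nondecreasing sequence
of the corresponding eigenvalues. Indices start at `0`: `lam 0`, `φ 0` are the first eigenvalue
and eigenvector, usually written `λ₁`, `φ₁`, and `lam 1` is `λ₂`. -/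
structure IsEigenbasis (A : X →ₗ.[ℝ] X) (φ : HilbertBasis ℕ ℝ X) (lam : ℕ → ℝ) : Prop where
  mono : Monotone lam
  eigen : ∀ k, ∃ h : φ k ∈ A.domain, A ⟨φ k, h⟩ = lam k • φ k

/-- The semigroup `e^{-tA} x = ∑ₖ e^{-λₖ t} ⟨x, φₖ⟩ φₖ`. -/
def semigroup (φ : HilbertBasis ℕ ℝ X) (lam : ℕ → ℝ) (t : ℝ) (x : X) : X :=
  ∑' k, (Real.exp (-(lam k) * t) * ⟪x, φ k⟫_ℝ) • φ k

/-- The domain `D(A^s)` of the fractional power, `s ≥ 0`. -/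
def fracDomain (φ : HilbertBasis ℕ ℝ X) (lam : ℕ → ℝ) (s : ℝ) : Set X :=
  {x | Summable fun k => lam k ^ (2 * s) * |⟪x, φ k⟫_ℝ| ^ 2}

/-- The fractional power `A^s x = ∑ₖ λₖ^s ⟨x, φₖ⟩ φₖ`, to be used for `x ∈ D(A^s)`. -/
def fracPow (φ : HilbertBasis ℕ ℝ X) (lam : ℕ → ℝ) (s : ℝ) (x : X) : X :=
  ∑' k, (lam k ^ s * ⟪x, φ k⟫_ℝ) • φ k

/-- The scalar product `⟨x, y⟩ₛ = ⟨x, y⟩ + ⟨A^s x, A^s y⟩` of `D(A^s)`. -/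
def fracInner (φ : HilbertBasis ℕ ℝ X) (lam : ℕ → ℝ) (s : ℝ) (x y : X) : ℝ :=
  ⟪x, y⟫_ℝ + ⟪fracPow φ lam s x, fracPow φ lam s y⟫_ℝ

/-- The norm `‖x‖ₛ = (‖x‖² + ‖A^s x‖²)^{1/2}` of `D(A^s)`. -/
def fracNorm (φ : HilbertBasis ℕ ℝ X) (lam : ℕ → ℝ) (s : ℝ) (x : X) : ℝ :=
  Real.sqrt (‖x‖ ^ 2 + ‖fracPow φ lam s x‖ ^ 2)

/-- `D(A^{1/2}) ↪ D(B)`: inclusion of the domains, and `‖B x‖ ≤ C ‖x‖_{1/2}` on `D(A^{1/2})`. -/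
def HalfBounded (φ : HilbertBasis ℕ ℝ X) (lam : ℕ → ℝ) (B : X →ₗ.[ℝ] X) : Prop :=
  ∃ C : ℝ, 0 < C ∧ ∀ x ∈ fracDomain φ lam (1 / 2),
    ∃ h : x ∈ B.domain, ‖B ⟨x, h⟩‖ ≤ C * fracNorm φ lam (1 / 2) x

open Classical in
/-- The value `B x` for `x ∈ D(B)` (and `0` outside `D(B)`, where it is never used). -/
def applyOp (B : X →ₗ.[ℝ] X) (x : X) : X :=
  if h : x ∈ B.domain then B ⟨x, h⟩ else 0

/-- Lebesgue measure on the interval `(0, T)`. -/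
def timeMeasure (T : ℝ) : Measure ℝ := volume.restrict (Ioc 0 T)

/-- The mild solution `y(t; y₀, p)` of `y' + A y + p(t) B φ₁ = 0`, `y(0) = y₀`. -/
def linSol (φ : HilbertBasis ℕ ℝ X) (lam : ℕ → ℝ) (B : X →ₗ.[ℝ] X)
    (y₀ : X) (p : ℝ → ℝ) (t : ℝ) : X :=
  semigroup φ lam t y₀ - ∫ s in (0 : ℝ)..t, semigroup φ lam (t - s) (p s • applyOp B (φ 0))

/-- `{A, B}` is `1`-null controllable in time `T`. -/
def OneNullControllable (φ : HilbertBasis ℕ ℝ X) (lam : ℕ → ℝ) (B : X →ₗ.[ℝ] X)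
    (T : ℝ) : Prop :=
  ∃ N : ℝ, 0 < N ∧ ∀ y₀ : X, ∃ p : ℝ → ℝ, MemLp p 2 (timeMeasure T) ∧
    eLpNorm p 2 (timeMeasure T) ≤ ENNReal.ofReal (N * ‖y₀‖) ∧ linSol φ lam B y₀ p T = 0

/-- The control cost `N(T) = sup_{‖y₀‖ = 1} inf {‖p‖_{L²(0,T)} : y(T; y₀, p) = 0}`, in `[0, ∞]`. -/
def controlCost (φ : HilbertBasis ℕ ℝ X) (lam : ℕ → ℝ) (B : X →ₗ.[ℝ] X) (T : ℝ) : ℝ≥0∞ :=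
  ⨆ (y₀ : X) (_ : ‖y₀‖ = 1), ⨅ (p : ℝ → ℝ) (_ : MemLp p 2 (timeMeasure T))
    (_ : linSol φ lam B y₀ p T = 0), eLpNorm p 2 (timeMeasure T)

/-- `u` is the (unique) mild solution, in `C([0, T]; D(A^{1/2}))`, of
`u' + A u + p(t) B u = 0`, `u(0) = u₀`. For such `u` and `p ∈ L²(0, T)` the function
`s ↦ p(s) B u(s)` is in `L²(0, T; X)`, so the integral is a genuine one. -/
structure IsSolution (φ : HilbertBasis ℕ ℝ X) (lam : ℕ → ℝ) (B : X →ₗ.[ℝ] X)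
    (T : ℝ) (u₀ : X) (p : ℝ → ℝ) (u : ℝ → X) : Prop where
  mem_domain : ∀ t ∈ Icc 0 T, u t ∈ fracDomain φ lam (1 / 2)
  continuous : ∀ t ∈ Icc 0 T,
    Tendsto (fun s => fracNorm φ lam (1 / 2) (u s - u t)) (𝓝[Icc 0 T] t) (𝓝 0)
  duhamel : ∀ t ∈ Icc 0 T, u t = semigroup φ lam t u₀ -
    ∫ s in (0 : ℝ)..t, semigroup φ lam (t - s) (p s • applyOp B (u s))

/-- The ground state solution `ψ₁(t) = e^{-λ₁ t} φ₁`. -/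
def groundState (φ : HilbertBasis ℕ ℝ X) (lam : ℕ → ℝ) (t : ℝ) : X :=
  Real.exp (-(lam 0) * t) • φ 0

/-- `u' + A u + p(t) B u = 0`, `u(0) = u₀` is exactly controllable to the ground state solution
in time `T`: some control `p ∈ L²(0, T)` gives `u(T; u₀, p) = ψ₁(T)`. -/
def ControllableToGroundState (φ : HilbertBasis ℕ ℝ X) (lam : ℕ → ℝ) (B : X →ₗ.[ℝ] X)
    (T : ℝ) (u₀ : X) : Prop :=
  ∃ p : ℝ → ℝ, MemLp p 2 (timeMeasure T) ∧
    ∃ u : ℝ → X, IsSolution φ lam B T u₀ p u ∧ u T = groundState φ lam T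

end ParabolicControl

end

/-! Put `z = e^{λ₁t}(I + A)^{1/2}u`. The energy norm of `u` becomes, up to the scalar factor, the
norm of `X`, the ground state becomes a stationary vector, and `B` becomes the bounded operator `b =
B(I + A)^{-1/2}`. The source term then carries the weights `√(1 + λₖ)`. The L² bound on Duhamel
integrals absorbs them (`mul_duhamel_sq_le`), so mild solutions exist and are unique for small
controls by contraction.

Local controllability (`exists_reach_ground`) is a Newton-type iteration. The null control of the
linearized system, inserted in the bilinear one, leaves an error quadratic in the initial one
(`exists_quadratic_step`). On intervals of length `θ/((j+1)(j+2))` the cost grows like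
`exp(N(j+1)(j+2))`, while errors decay like `exp(-α(j+4)²)`. The controls therefore have summable
energy, and the trajectory hits the ground state at time `θ ≤ 1`.

For large data, zero control damps everything orthogonal to `φ₁` at rate `λ₂ - λ₁`, which is
positive because a scalar control cannot steer a double eigenvalue (`ne_of_controlCost_le`). One
difficulty remains: `⟨φ₁, φ₁⟩_{1/2} = 1 + λ₁ =: c`, so the hypothesis puts the `φ₁`-component near
`1/c` instead of `1`. As the system is linear in the state, the local result rescales to every
positive multiple of the ground state, and finitely many unit-time steps climb from `1/c` to `1`
(`reach_chain`). The extra time fits into `T_R`: if `λ₁ > 0`, the hypotheses bound `R` from below,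
so a small `r₁` makes `T_R` as long as needed. -/

namespace ParabolicControl

/-! ### Coordinates in a Hilbert basis. -/

section Coordinates

variable {X : Type*} [NormedAddCommGroup X] [InnerProductSpace ℝ X]

lemma hasSum_sq_coord (φ : HilbertBasis ℕ ℝ X) (x : X) :
    HasSum (fun k => ⟪φ k, x⟫_ℝ ^ 2) (‖x‖ ^ 2) := by
  have h := φ.hasSum_inner_mul_inner x x
  rw [real_inner_self_eq_norm_sq] at h
  refine h.congr_fun ?_
  intro k
  rw [real_inner_comm, sq]

lemma ext_coord (φ : HilbertBasis ℕ ℝ X) {x y : X} (h : ∀ k, ⟪φ k, x⟫_ℝ = ⟪φ k, y⟫_ℝ) :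
    x = y := by
  have h1 := hasSum_sq_coord φ (x - y)
  have h2 : (fun k => ⟪φ k, x - y⟫_ℝ ^ 2) = fun _ => 0 := by
    funext k
    rw [inner_sub_right, h k, sub_self]
    simp
  rw [h2] at h1
  have h3 := h1.unique hasSum_zero
  have h4 : ‖x - y‖ = 0 := by simpa using h3
  exact sub_eq_zero.mp (norm_eq_zero.mp h4)

lemma exists_coord_eq (φ : HilbertBasis ℕ ℝ X) {c : ℕ → ℝ} (hc : Summable fun k => c k ^ 2) :
    ∃ x : X, ∀ k, ⟪φ k, x⟫_ℝ = c k := by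
  have hm : Memℓp c 2 := by
    rw [memℓp_gen_iff (by norm_num)]
    simpa using hc
  refine ⟨φ.repr.symm ⟨c, hm⟩, fun k => ?_⟩
  rw [← φ.repr_apply_apply]
  simp

lemma coord_basis (φ : HilbertBasis ℕ ℝ X) (i j : ℕ) :
    ⟪φ i, φ j⟫_ℝ = if i = j then 1 else 0 :=
  orthonormal_iff_ite.mp φ.orthonormal i j

lemma norm_sq_le_of_coord (φ : HilbertBasis ℕ ℝ X) {x : X} {C : ℝ}
    (h : ∀ u : Finset ℕ, ∑ k ∈ u, ⟪φ k, x⟫_ℝ ^ 2 ≤ C) : ‖x‖ ^ 2 ≤ C := by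
  rw [← (hasSum_sq_coord φ x).tsum_eq]
  exact Real.tsum_le_of_sum_le (fun k => sq_nonneg _) h

lemma norm_le_of_abs_coord_le (φ : HilbertBasis ℕ ℝ X) {x y : X}
    (h : ∀ k, |⟪φ k, x⟫_ℝ| ≤ |⟪φ k, y⟫_ℝ|) : ‖x‖ ≤ ‖y‖ := by
  refine (sq_le_sq₀ (norm_nonneg _) (norm_nonneg _)).mp ?_
  refine hasSum_le (fun k => ?_) (hasSum_sq_coord φ x) (hasSum_sq_coord φ y)
  exact sq_le_sq.mpr (h k)

/-- A summable majorant independent of `t` allows dominated convergence in the series of `‖z r - z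
t‖²`; the factor 4 comes from `(x - y)² ≤ 2x² + 2y²`. -/
lemma continuousOn_of_coord (φ : HilbertBasis ℕ ℝ X) {s : Set ℝ} {z : ℝ → X} {a : ℕ → ℝ}
    (ha : Summable a) (hz : ∀ t ∈ s, ∀ k, ⟪φ k, z t⟫_ℝ ^ 2 ≤ a k)
    (hc : ∀ k, ContinuousOn (fun t => ⟪φ k, z t⟫_ℝ) s) : ContinuousOn z s := by
  intro t ht
  have key : Tendsto (fun r => ∑' k, ⟪φ k, z r - z t⟫_ℝ ^ 2) (𝓝[s] t) (𝓝 (∑' _ : ℕ, (0 : ℝ))) := by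
    refine tendsto_tsum_of_dominated_convergence (ha.mul_left 4) (fun k => ?_) ?_
    · have h1 := ((hc k t ht).tendsto.sub_const ⟪φ k, z t⟫_ℝ).pow 2
      simpa [inner_sub_right] using h1
    · filter_upwards [self_mem_nhdsWithin] with r hr k
      rw [Real.norm_eq_abs, abs_of_nonneg (sq_nonneg _), inner_sub_right]
      have h1 := hz r hr k
      have h2 := hz t ht k
      nlinarith [sq_nonneg (⟪φ k, z r⟫_ℝ + ⟪φ k, z t⟫_ℝ)]
  rw [tsum_zero] at key
  have h2 : Tendsto (fun r => ‖z r - z t‖ ^ 2) (𝓝[s] t) (𝓝 0) :=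
    key.congr fun r => (hasSum_sq_coord φ (z r - z t)).tsum_eq
  have h3 := h2.sqrt
  rw [Real.sqrt_zero] at h3
  refine tendsto_iff_norm_sub_tendsto_zero.mpr (h3.congr fun r => ?_)
  exact Real.sqrt_sq (norm_nonneg _)

end Coordinates

/-! ### Scalar Duhamel integrals and their L² bounds. -/

section Duhamel

/-- The Duhamel integral `∫₀ᵗ e^{-m(t-s)} f(s) ds` of the scalar equation `y' + m y = f`. -/
noncomputable def duhamel (m : ℝ) (f : ℝ → ℝ) (t : ℝ) : ℝ :=
  ∫ s in (0 : ℝ)..t, Real.exp (-m * (t - s)) * f s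

lemma duhamel_eq (m : ℝ) (f : ℝ → ℝ) (t : ℝ) :
    duhamel m f t = Real.exp (-m * t) * ∫ s in (0 : ℝ)..t, Real.exp (m * s) * f s := by
  rw [duhamel, ← intervalIntegral.integral_const_mul]
  refine intervalIntegral.integral_congr fun s _ => ?_
  rw [← mul_assoc, ← Real.exp_add]
  ring_nf

lemma duhamel_zero (m : ℝ) (f : ℝ → ℝ) : duhamel m f 0 = 0 := by
  simp [duhamel]

lemma duhamel_congr {m : ℝ} {f g : ℝ → ℝ} {t : ℝ} (ht : 0 ≤ t) (h : ∀ s ∈ Ioc 0 t, f s = g s) :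
    duhamel m f t = duhamel m g t := by
  refine intervalIntegral.integral_congr_uIoo fun s hs => ?_
  rw [uIoo_of_le ht] at hs
  rw [h s ⟨hs.1, hs.2.le⟩]

lemma _root_.MeasureTheory.IntegrableOn.exp_mul {f : ℝ → ℝ} {a b : ℝ} (m : ℝ)
    (hf : IntegrableOn f (Ioc a b)) :
    IntegrableOn (fun s => Real.exp (m * s) * f s) (Ioc a b) := by
  refine IntegrableOn.continuousOn_mul_of_subset (K := Icc a b) ?_ hf isCompact_Icc
    measurableSet_Ioc Ioc_subset_Icc_self
  fun_prop

lemma intervalIntegrable_of_Ioc {f : ℝ → ℝ} {T a b : ℝ} (hf : IntegrableOn f (Ioc 0 T))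
    (ha : 0 ≤ a) (hab : a ≤ b) (hb : b ≤ T) : IntervalIntegrable f volume a b := by
  rw [intervalIntegrable_iff_integrableOn_Ioc_of_le hab]
  exact hf.mono_set (Ioc_subset_Ioc ha hb)

lemma continuousOn_duhamel (m : ℝ) {f : ℝ → ℝ} {T : ℝ} (hT : 0 ≤ T)
    (hf : IntegrableOn f (Ioc 0 T)) : ContinuousOn (duhamel m f) (Icc 0 T) := by
  have h1 : IntegrableOn (fun s => Real.exp (m * s) * f s) (uIcc 0 T) := by
    rw [uIcc_of_le hT, integrableOn_Icc_iff_integrableOn_Ioc]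
    exact hf.exp_mul m
  have h2 := intervalIntegral.continuousOn_primitive_interval h1
  rw [uIcc_of_le hT] at h2
  have h3 : ContinuousOn (fun t : ℝ => Real.exp (-m * t)) (Icc 0 T) := by fun_prop
  exact (h3.mul h2).congr fun t _ => duhamel_eq m f t

lemma duhamel_sub {m : ℝ} {f g : ℝ → ℝ} {t : ℝ} (ht : 0 ≤ t)
    (hf : IntegrableOn f (Ioc 0 t)) (hg : IntegrableOn g (Ioc 0 t)) :
    duhamel m (fun s => f s - g s) t = duhamel m f t - duhamel m g t := by
  simp only [duhamel_eq]
  rw [← mul_sub, ← intervalIntegral.integral_sub]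
  · simp only [mul_sub]
  · exact intervalIntegrable_of_Ioc (hf.exp_mul m) le_rfl ht le_rfl
  · exact intervalIntegrable_of_Ioc (hg.exp_mul m) le_rfl ht le_rfl

lemma duhamel_const_mul (m c : ℝ) (f : ℝ → ℝ) (t : ℝ) :
    duhamel m (fun s => c * f s) t = c * duhamel m f t := by
  rw [duhamel, duhamel, ← intervalIntegral.integral_const_mul]
  refine intervalIntegral.integral_congr fun s _ => ?_
  ring

/-- The scalar flow property on which restarting and concatenating trajectories rest. -/
lemma duhamel_add_time {m : ℝ} {f : ℝ → ℝ} {r t : ℝ} (hr : 0 ≤ r) (ht : 0 ≤ t)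
    (hf : IntegrableOn f (Ioc 0 (r + t))) :
    duhamel m f (r + t) =
      Real.exp (-m * t) * duhamel m f r + duhamel m (fun s => f (r + s)) t := by
  have hi := hf.exp_mul m
  have h1 := intervalIntegrable_of_Ioc hi le_rfl hr (by linarith)
  have h2 := intervalIntegrable_of_Ioc hi hr (by linarith : r ≤ r + t) le_rfl
  rw [duhamel_eq m f (r + t), ← intervalIntegral.integral_add_adjacent_intervals h1 h2,
    duhamel_eq m f r, duhamel_eq m _ t]
  have h3 := intervalIntegral.integral_comp_add_left (a := 0) (b := t)
    (fun s => Real.exp (m * s) * f s) r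
  rw [add_zero] at h3
  rw [← h3, mul_add, ← mul_assoc, ← Real.exp_add]
  congr 1
  · ring_nf
  · rw [← intervalIntegral.integral_const_mul, ← intervalIntegral.integral_const_mul]
    refine intervalIntegral.integral_congr fun s _ => ?_
    rw [← mul_assoc, ← mul_assoc, ← Real.exp_add, ← Real.exp_add]
    ring_nf

lemma sq_integral_mul_le {α : Type*} [MeasurableSpace α] {ν : Measure α} {f g : α → ℝ}
    (hf : MemLp f 2 ν) (hg : MemLp g 2 ν) :
    (∫ a, f a * g a ∂ν) ^ 2 ≤ (∫ a, f a ^ 2 ∂ν) * ∫ a, g a ^ 2 ∂ν := by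
  have h := integral_mul_norm_le_Lp_mul_Lq (μ := ν) (f := f) (g := g) Real.HolderConjugate.two_two
    (by simpa using hf) (by simpa using hg)
  have h0 : |∫ a, f a * g a ∂ν| ≤ ∫ a, ‖f a‖ * ‖g a‖ ∂ν := by
    refine (abs_integral_le_integral_abs).trans_eq ?_
    simp [abs_mul]
  simp only [Real.rpow_two, Real.norm_eq_abs, sq_abs, ← Real.sqrt_eq_rpow] at h h0
  rw [← Real.sqrt_mul (integral_nonneg fun a => sq_nonneg _)] at h
  rw [← sq_abs]
  refine (pow_le_pow_left₀ (abs_nonneg _) (h0.trans h) 2).trans_eq (Real.sq_sqrt ?_)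
  exact mul_nonneg (integral_nonneg fun a => sq_nonneg _) (integral_nonneg fun a => sq_nonneg _)

/-- The left side equals `(1 - e^{-2mt})/2`. Uniformity in `m` is what later compensates the
unbounded weights. -/
lemma mul_integral_exp_sq_le (m t : ℝ) :
    m * ∫ s in (0 : ℝ)..t, Real.exp (-m * (t - s)) ^ 2 ≤ 1 / 2 := by
  have h : ∀ s ∈ uIcc 0 t, HasDerivAt (fun s => Real.exp (-(2 * m) * (t - s)) / 2)
      (m * Real.exp (-m * (t - s)) ^ 2) s := by
    intro s _
    have h1 : HasDerivAt (fun s : ℝ => -(2 * m) * (t - s)) (2 * m) s := by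
      have := ((hasDerivAt_id s).const_sub t).const_mul (-(2 * m))
      simpa using this
    have h2 := h1.exp.div_const 2
    have h3 : m * Real.exp (-m * (t - s)) ^ 2 =
        Real.exp (-(2 * m) * (t - s)) * (2 * m) / 2 := by
      rw [← Real.exp_nat_mul]
      push_cast
      ring_nf
    rw [h3]
    exact h2
  rw [← intervalIntegral.integral_const_mul, intervalIntegral.integral_eq_sub_of_hasDerivAt h]
  · have := Real.exp_pos (-(2 * m) * (t - 0))
    simp only [sub_self, mul_zero, Real.exp_zero]
    linarith
  · exact Continuous.intervalIntegrable (by fun_prop) _ _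

lemma integral_exp_sq_le {m t : ℝ} (hm : 0 ≤ m) (ht : 0 ≤ t) :
    ∫ s in (0 : ℝ)..t, Real.exp (-m * (t - s)) ^ 2 ≤ t := by
  have h := intervalIntegral.integral_mono_on (μ := volume) (a := 0) (b := t)
    (f := fun s => Real.exp (-m * (t - s)) ^ 2) (g := fun _ => (1 : ℝ)) ht
    (Continuous.intervalIntegrable (by fun_prop) _ _)
    (Continuous.intervalIntegrable (by fun_prop) _ _) (fun s hs => by
      have : Real.exp (-m * (t - s)) ≤ 1 := by
        rw [Real.exp_le_one_iff]
        nlinarith [hs.2]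
      exact pow_le_one₀ (Real.exp_pos _).le this)
  simpa using h

/-- The parabolic gain of half a derivative. -/
lemma mul_duhamel_sq_le {m c t T : ℝ} (hm : 0 ≤ m) (hc : 0 ≤ c) (ht : 0 ≤ t) (ht1 : t ≤ 1)
    (htT : t ≤ T) {f : ℝ → ℝ} (hf : MemLp f 2 (timeMeasure T)) :
    (c + m) * duhamel m f t ^ 2 ≤ (c + 1 / 2) * ∫ s in Ioc 0 t, f s ^ 2 := by
  have hft : MemLp f 2 (volume.restrict (Ioc 0 t)) :=
    hf.mono_measure (Measure.restrict_mono (Ioc_subset_Ioc_right htT) le_rfl)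
  have he : MemLp (fun s => Real.exp (-m * (t - s))) 2 (volume.restrict (Ioc 0 t)) := by
    have h1 : ContinuousOn (fun s => Real.exp (-m * (t - s)) ^ 2) (Icc 0 t) := by fun_prop
    rw [memLp_two_iff_integrable_sq (by fun_prop)]
    exact h1.integrableOn_Icc.mono_set Ioc_subset_Icc_self
  have h1 := sq_integral_mul_le he hft
  have h2 := mul_integral_exp_sq_le m t
  have h3 := integral_exp_sq_le hm ht
  rw [intervalIntegral.integral_of_le ht] at h2 h3
  rw [duhamel, intervalIntegral.integral_of_le ht]
  have h4 : 0 ≤ ∫ s in Ioc 0 t, f s ^ 2 := integral_nonneg fun s => sq_nonneg _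
  calc _ ≤ (c + m) * ((∫ s in Ioc 0 t, Real.exp (-m * (t - s)) ^ 2) *
      ∫ s in Ioc 0 t, f s ^ 2) := by gcongr
    _ = ((c + m) * (∫ s in Ioc 0 t, Real.exp (-m * (t - s)) ^ 2)) *
      ∫ s in Ioc 0 t, f s ^ 2 := by ring
    _ ≤ _ := by
      -- The two kernel bounds give `c * t + 1 / 2`, and `t ≤ 1`.
      gcongr
      nlinarith

end Duhamel

section Vector

variable {X : Type*} [NormedAddCommGroup X] [InnerProductSpace ℝ X]

lemma sum_integral_coord_sq_le (φ : HilbertBasis ℕ ℝ X) {ν : Measure ℝ} {f : ℝ → X}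
    (hf : MemLp f 2 ν) (u : Finset ℕ) :
    ∑ k ∈ u, ∫ s, ⟪φ k, f s⟫_ℝ ^ 2 ∂ν ≤ ∫ s, ‖f s‖ ^ 2 ∂ν := by
  have hi : ∀ k ∈ u, Integrable (fun s => ⟪φ k, f s⟫_ℝ ^ 2) ν := fun k _ =>
    (hf.const_inner (φ k)).integrable_sq
  rw [← integral_finsetSum u hi]
  refine integral_mono (integrable_finsetSum u hi) ?_ fun s => ?_
  · exact (memLp_two_iff_integrable_sq_norm hf.1).mp hf
  · exact sum_le_hasSum u (fun k _ => sq_nonneg _) (hasSum_sq_coord φ (f s))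

lemma summable_integral_coord_sq (φ : HilbertBasis ℕ ℝ X) {ν : Measure ℝ} {f : ℝ → X}
    (hf : MemLp f 2 ν) : Summable fun k => ∫ s, ⟪φ k, f s⟫_ℝ ^ 2 ∂ν :=
  summable_of_sum_le (fun _ => integral_nonneg fun _ => sq_nonneg _)
    (sum_integral_coord_sq_le φ hf)

end Vector

end ParabolicControl

/-! ### The diagonal system and its well-posedness for small controls. -/

namespace ParabolicControl

/-- A bilinear control system in diagonal form: `μ` are the decay rates, `c + μ k` the weights of
the energy norm, and `b` is the control operator, bounded on the energy space. -/
structure DiagonalSystem (X : Type*) [NormedAddCommGroup X] [InnerProductSpace ℝ X] where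
  φ : HilbertBasis ℕ ℝ X
  μ : ℕ → ℝ
  c : ℝ
  b : X →L[ℝ] X
  μ_nonneg : ∀ k, 0 ≤ μ k
  μ_zero : μ 0 = 0
  one_le_c : 1 ≤ c

namespace DiagonalSystem

variable {X : Type*} [NormedAddCommGroup X] [InnerProductSpace ℝ X] (D : DiagonalSystem X)

/-- The weights of the energy norm. -/
def w (k : ℕ) : ℝ := D.c + D.μ k

/-- The norm of the map from controls to states. -/
noncomputable def gain : ℝ := √(D.c + 1 / 2) * ‖D.b‖

lemma one_le_w (k : ℕ) : 1 ≤ D.w k := by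
  have := D.one_le_c
  have := D.μ_nonneg k
  unfold w
  linarith

lemma gain_nonneg : 0 ≤ D.gain := by
  unfold gain
  positivity

/-- `z` is a mild solution, written in coordinates, of `z' + D z + p(t) b z = 0`, `z(0) = z₀`. -/
structure IsMild (T : ℝ) (z₀ : X) (p : ℝ → ℝ) (z : ℝ → X) : Prop where
  continuousOn : ContinuousOn z (Icc 0 T)
  coord : ∀ t ∈ Icc 0 T, ∀ k, ⟪D.φ k, z t⟫_ℝ = Real.exp (-(D.μ k) * t) * ⟪D.φ k, z₀⟫_ℝ -
    √(D.w k) * duhamel (D.μ k) (fun s => p s * ⟪D.φ k, D.b (z s)⟫_ℝ) t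

variable {D}

lemma memLp_source {T : ℝ} {p : ℝ → ℝ} {z : ℝ → X} (hp : MemLp p 2 (timeMeasure T))
    (hz : ContinuousOn z (Icc 0 T)) : MemLp (fun s => p s • D.b (z s)) 2 (timeMeasure T) := by
  have hbz : ContinuousOn (fun s => D.b (z s)) (Icc 0 T) := D.b.continuous.comp_continuousOn hz
  obtain ⟨C, hC⟩ := isCompact_Icc.exists_bound_of_continuousOn hbz
  have hm : AEStronglyMeasurable (fun s => D.b (z s)) (timeMeasure T) :=
    (hbz.mono Ioc_subset_Icc_self).aestronglyMeasurable measurableSet_Ioc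
  refine MemLp.of_le_mul (c := C) hp (hp.1.smul hm) ?_
  refine (ae_restrict_iff' measurableSet_Ioc).mpr (ae_of_all _ fun s hs => ?_)
  rw [norm_smul, mul_comm]
  gcongr
  exact hC s (Ioc_subset_Icc_self hs)

lemma integrableOn_of_memLp_two {E : Type*} [NormedAddCommGroup E] {T : ℝ} {f : ℝ → E}
    (hf : MemLp f 2 (timeMeasure T)) : IntegrableOn f (Ioc 0 T) := by
  have : IsFiniteMeasure (timeMeasure T) := by
    unfold timeMeasure
    infer_instance
  exact hf.integrable (by norm_num)

lemma inner_source (p : ℝ → ℝ) (z : ℝ → X) (k : ℕ) :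
    (fun s => ⟪D.φ k, p s • D.b (z s)⟫_ℝ) = fun s => p s * ⟪D.φ k, D.b (z s)⟫_ℝ := by
  funext s
  rw [inner_smul_right]

lemma integrableOn_source {T : ℝ} {p : ℝ → ℝ} {z : ℝ → X} (hp : MemLp p 2 (timeMeasure T))
    (hz : ContinuousOn z (Icc 0 T)) (k : ℕ) :
    IntegrableOn (fun s => p s * ⟪D.φ k, D.b (z s)⟫_ℝ) (Ioc 0 T) := by
  rw [← inner_source]
  exact integrableOn_of_memLp_two ((memLp_source hp hz).const_inner (D.φ k))

lemma integral_source_le {t T m : ℝ} {p : ℝ → ℝ} {z : ℝ → X} (htT : t ≤ T)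
    (hp : MemLp p 2 (timeMeasure T)) (hz : ContinuousOn z (Icc 0 T))
    (hm : ∀ s ∈ Icc 0 t, ‖z s‖ ≤ m) :
    ∫ s in Ioc 0 t, ‖p s • D.b (z s)‖ ^ 2 ≤ (‖D.b‖ * m) ^ 2 * ∫ s in Ioc 0 t, p s ^ 2 := by
  have hr : volume.restrict (Ioc 0 t) ≤ timeMeasure T :=
    Measure.restrict_mono (Ioc_subset_Ioc_right htT) le_rfl
  have h1 := (memLp_source (D := D) hp hz).mono_measure hr
  have h2 := hp.mono_measure hr
  rw [← integral_const_mul]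
  refine setIntegral_mono_on ((memLp_two_iff_integrable_sq_norm h1.1).mp h1)
    (h2.integrable_sq.const_mul _) measurableSet_Ioc fun s hs => ?_
  have h3 : ‖p s • D.b (z s)‖ ≤ |p s| * (‖D.b‖ * m) := by
    rw [norm_smul, Real.norm_eq_abs]
    gcongr
    refine (D.b.le_opNorm _).trans ?_
    gcongr
    exact hm s (Ioc_subset_Icc_self hs)
  calc _ ≤ (|p s| * (‖D.b‖ * m)) ^ 2 := by gcongr
    _ = _ := by
      rw [mul_pow, sq_abs]
      ring

lemma sqrt_w_mul_duhamel_sq_le {f : ℝ → ℝ} {t T : ℝ} (ht : 0 ≤ t) (ht1 : t ≤ 1) (htT : t ≤ T)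
    (hf : MemLp f 2 (timeMeasure T)) (k : ℕ) :
    (√(D.w k) * duhamel (D.μ k) f t) ^ 2 ≤ (D.c + 1 / 2) * ∫ s in Ioc 0 t, f s ^ 2 := by
  rw [mul_pow, Real.sq_sqrt (zero_le_one.trans (D.one_le_w k))]
  exact mul_duhamel_sq_le (D.μ_nonneg k) (zero_le_one.trans D.one_le_c) ht ht1 htT hf

/-- The factor `√(D.w k)` is the half derivative lost by the source; the scalar gain recovers it in
each coordinate, uniformly in `k`, and Bessel's inequality sums the result. -/
lemma norm_le_of_coord_eq_duhamel {f : ℝ → X} {t T : ℝ} (ht : 0 ≤ t) (ht1 : t ≤ 1) (htT : t ≤ T)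
    (hf : MemLp f 2 (timeMeasure T)) {x : X}
    (hx : ∀ k, ⟪D.φ k, x⟫_ℝ = √(D.w k) * duhamel (D.μ k) (fun s => ⟪D.φ k, f s⟫_ℝ) t) :
    ‖x‖ ^ 2 ≤ (D.c + 1 / 2) * ∫ s in Ioc 0 t, ‖f s‖ ^ 2 := by
  have hft : MemLp f 2 (volume.restrict (Ioc 0 t)) :=
    hf.mono_measure (Measure.restrict_mono (Ioc_subset_Ioc_right htT) le_rfl)
  refine norm_sq_le_of_coord D.φ fun u => ?_
  have hc : 0 ≤ D.c + 1 / 2 := by linarith [D.one_le_c]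
  calc _ ≤ ∑ k ∈ u, (D.c + 1 / 2) * ∫ s in Ioc 0 t, ⟪D.φ k, f s⟫_ℝ ^ 2 := by
        refine Finset.sum_le_sum fun k _ => ?_
        rw [hx k]
        exact sqrt_w_mul_duhamel_sq_le ht ht1 htT (hf.const_inner _) k
    _ = (D.c + 1 / 2) * ∑ k ∈ u, ∫ s in Ioc 0 t, ⟪D.φ k, f s⟫_ℝ ^ 2 := by rw [Finset.mul_sum]
    _ ≤ _ := by
      gcongr
      exact sum_integral_coord_sq_le D.φ hft u

lemma exp_neg_mul_le_one (k : ℕ) {t : ℝ} (ht : 0 ≤ t) : Real.exp (-(D.μ k) * t) ≤ 1 := by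
  rw [Real.exp_le_one_iff]
  nlinarith [D.μ_nonneg k]

lemma abs_exp_mul_le (k : ℕ) {t : ℝ} (ht : 0 ≤ t) (a : ℝ) :
    |Real.exp (-(D.μ k) * t) * a| ≤ |a| := by
  rw [abs_mul, abs_of_pos (Real.exp_pos _)]
  exact mul_le_of_le_one_left (abs_nonneg _) (exp_neg_mul_le_one k ht)

variable (D) in
lemma exists_flow (y : X) {t : ℝ} (ht : 0 ≤ t) :
    ∃ x : X, (∀ k, ⟪D.φ k, x⟫_ℝ = Real.exp (-(D.μ k) * t) * ⟪D.φ k, y⟫_ℝ) ∧ ‖x‖ ≤ ‖y‖ := by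
  have hs : Summable fun k => (Real.exp (-(D.μ k) * t) * ⟪D.φ k, y⟫_ℝ) ^ 2 := by
    refine (hasSum_sq_coord D.φ y).summable.of_nonneg_of_le (fun k => sq_nonneg _) fun k => ?_
    exact sq_le_sq.mpr (abs_exp_mul_le k ht _)
  obtain ⟨x, hx⟩ := exists_coord_eq D.φ hs
  refine ⟨x, hx, norm_le_of_abs_coord_le D.φ fun k => ?_⟩
  rw [hx k]
  exact abs_exp_mul_le k ht _

variable (D) in
lemma exists_duhamel (z₀ : X) {f : ℝ → X} (hf : MemLp f 2 (timeMeasure 1)) :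
    ∃ z : ℝ → X, ContinuousOn z (Icc 0 1) ∧ ∀ t ∈ Icc (0 : ℝ) 1, ∀ k,
      ⟪D.φ k, z t⟫_ℝ = Real.exp (-(D.μ k) * t) * ⟪D.φ k, z₀⟫_ℝ -
        √(D.w k) * duhamel (D.μ k) (fun s => ⟪D.φ k, f s⟫_ℝ) t := by
  set F : ℝ → ℕ → ℝ := fun t k => Real.exp (-(D.μ k) * t) * ⟪D.φ k, z₀⟫_ℝ -
        √(D.w k) * duhamel (D.μ k) (fun s => ⟪D.φ k, f s⟫_ℝ) t with hF
  set a : ℕ → ℝ := fun k => 2 * ⟪D.φ k, z₀⟫_ℝ ^ 2 +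
    2 * ((D.c + 1 / 2) * ∫ s in Ioc 0 1, ⟪D.φ k, f s⟫_ℝ ^ 2) with ha
  have hsum : Summable a := by
    refine ((hasSum_sq_coord D.φ z₀).summable.mul_left 2).add (Summable.mul_left 2 ?_)
    exact (summable_integral_coord_sq D.φ hf).mul_left _
  have hle : ∀ t ∈ Icc (0 : ℝ) 1, ∀ k, F t k ^ 2 ≤ a k := by
    intro t ht k
    have h1 := sq_le_sq.mpr (abs_exp_mul_le (D := D) k ht.1 ⟪D.φ k, z₀⟫_ℝ)
    have h2 := sqrt_w_mul_duhamel_sq_le (D := D) ht.1 ht.2 ht.2 (hf.const_inner (D.φ k)) k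
    have h3 : ∫ s in Ioc 0 t, ⟪D.φ k, f s⟫_ℝ ^ 2 ≤ ∫ s in Ioc 0 1, ⟪D.φ k, f s⟫_ℝ ^ 2 := by
      refine setIntegral_mono_set (hf.const_inner (D.φ k)).integrable_sq
        (ae_of_all _ fun s => sq_nonneg _) ?_
      exact (Ioc_subset_Ioc_right ht.2).eventuallyLE
    have h4 := mul_le_mul_of_nonneg_left h3 (by linarith [D.one_le_c] : 0 ≤ D.c + 1 / 2)
    simp only [hF, ha]
    nlinarith [sq_nonneg (Real.exp (-(D.μ k) * t) * ⟪D.φ k, z₀⟫_ℝ +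
        √(D.w k) * duhamel (D.μ k) (fun s => ⟪D.φ k, f s⟫_ℝ) t)]
  have hex : ∀ t : ℝ, ∃ x : X, t ∈ Icc (0 : ℝ) 1 → ∀ k, ⟪D.φ k, x⟫_ℝ = F t k := by
    intro t
    by_cases ht : t ∈ Icc (0 : ℝ) 1
    · obtain ⟨x, hx⟩ := exists_coord_eq D.φ
        (hsum.of_nonneg_of_le (fun k => sq_nonneg _) (hle t ht))
      exact ⟨x, fun _ => hx⟩
    · exact ⟨0, fun h => absurd h ht⟩
  choose z hz using hex
  refine ⟨z, continuousOn_of_coord D.φ hsum (fun t ht k => ?_) (fun k => ?_), hz⟩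
  · rw [hz t ht k]
    exact hle t ht k
  · have h1 : ContinuousOn (fun t => F t k) (Icc 0 1) := by
      have h2 := continuousOn_duhamel (D.μ k) zero_le_one
        (integrableOn_of_memLp_two (hf.const_inner (D.φ k)))
      simp only [hF]
      exact ContinuousOn.sub (by fun_prop) (continuousOn_const.mul h2)
    exact h1.congr fun t ht => hz t ht k

/-- The basic a priori estimate. -/
lemma norm_le_add {t T m η : ℝ} {p : ℝ → ℝ} {z : ℝ → X} (ht : 0 ≤ t) (ht1 : t ≤ 1) (htT : t ≤ T)
    (hp : MemLp p 2 (timeMeasure T)) (hz : ContinuousOn z (Icc 0 T))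
    (hm : ∀ s ∈ Icc 0 t, ‖z s‖ ≤ m) (hη : 0 ≤ η) (hpη : ∫ s in Ioc 0 T, p s ^ 2 ≤ η ^ 2)
    {x y : X} (hx : ∀ k, ⟪D.φ k, x⟫_ℝ = Real.exp (-(D.μ k) * t) * ⟪D.φ k, y⟫_ℝ -
      √(D.w k) * duhamel (D.μ k) (fun s => p s * ⟪D.φ k, D.b (z s)⟫_ℝ) t) :
    ‖x‖ ≤ ‖y‖ + D.gain * η * m := by
  obtain ⟨y', hy', hyy'⟩ := D.exists_flow y ht
  have hm0 : 0 ≤ m := (norm_nonneg _).trans (hm 0 ⟨le_rfl, ht⟩)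
  have h1 : ‖y' - x‖ ^ 2 ≤ (D.c + 1 / 2) * ∫ s in Ioc 0 t, ‖p s • D.b (z s)‖ ^ 2 := by
    refine norm_le_of_coord_eq_duhamel ht ht1 htT (memLp_source hp hz) fun k => ?_
    rw [inner_source, inner_sub_right, hy' k, hx k]
    ring
  have h2 := integral_source_le (D := D) htT hp hz hm
  have h3 : ∫ s in Ioc 0 t, p s ^ 2 ≤ η ^ 2 := by
    refine (setIntegral_mono_set hp.integrable_sq (ae_of_all _ fun s => sq_nonneg _) ?_).trans hpη
    exact (Ioc_subset_Ioc_right htT).eventuallyLE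
  have hc : 0 ≤ D.c + 1 / 2 := by linarith [D.one_le_c]
  have h4 : ‖y' - x‖ ^ 2 ≤ (D.gain * η * m) ^ 2 := by
    calc _ ≤ _ := h1
      _ ≤ (D.c + 1 / 2) * ((‖D.b‖ * m) ^ 2 * η ^ 2) := by
        gcongr
        exact h2.trans (by gcongr)
      _ = _ := by
        simp only [gain, mul_pow]
        rw [Real.sq_sqrt hc]
        ring
  have h5 : ‖y' - x‖ ≤ D.gain * η * m :=
    (sq_le_sq₀ (norm_nonneg _) (by have := D.gain_nonneg; positivity)).mp h4
  calc ‖x‖ = ‖y' - (y' - x)‖ := by rw [sub_sub_cancel]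
    _ ≤ ‖y'‖ + ‖y' - x‖ := norm_sub_le _ _
    _ ≤ _ := by gcongr

lemma coord_sub {t T : ℝ} {p : ℝ → ℝ} {z₁ z₂ : ℝ → X} (ht : 0 ≤ t) (htT : t ≤ T)
    (hp : MemLp p 2 (timeMeasure T)) (hz₁ : ContinuousOn z₁ (Icc 0 T))
    (hz₂ : ContinuousOn z₂ (Icc 0 T)) {x₁ x₂ y₁ y₂ : X} {k : ℕ}
    (hx₁ : ⟪D.φ k, x₁⟫_ℝ = Real.exp (-(D.μ k) * t) * ⟪D.φ k, y₁⟫_ℝ -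
      √(D.w k) * duhamel (D.μ k) (fun s => p s * ⟪D.φ k, D.b (z₁ s)⟫_ℝ) t)
    (hx₂ : ⟪D.φ k, x₂⟫_ℝ = Real.exp (-(D.μ k) * t) * ⟪D.φ k, y₂⟫_ℝ -
      √(D.w k) * duhamel (D.μ k) (fun s => p s * ⟪D.φ k, D.b (z₂ s)⟫_ℝ) t) :
    ⟪D.φ k, x₁ - x₂⟫_ℝ = Real.exp (-(D.μ k) * t) * ⟪D.φ k, y₁ - y₂⟫_ℝ -
      √(D.w k) * duhamel (D.μ k) (fun s => p s * ⟪D.φ k, D.b (z₁ s - z₂ s)⟫_ℝ) t := by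
  have h1 := (integrableOn_source (D := D) hp hz₁ k).mono_set (Ioc_subset_Ioc_right htT)
  have h2 := (integrableOn_source (D := D) hp hz₂ k).mono_set (Ioc_subset_Ioc_right htT)
  have h3 : (fun s => p s * ⟪D.φ k, D.b (z₁ s - z₂ s)⟫_ℝ) =
      fun s => p s * ⟪D.φ k, D.b (z₁ s)⟫_ℝ - p s * ⟪D.φ k, D.b (z₂ s)⟫_ℝ := by
    funext s
    rw [map_sub, inner_sub_right, mul_sub]
  rw [h3, duhamel_sub ht h1 h2, inner_sub_right, inner_sub_right, hx₁, hx₂]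
  ring

/-- Uniqueness of mild solutions for small controls. -/
lemma IsMild.eqOn {T η : ℝ} {p : ℝ → ℝ} {z₀ : X} {z₁ z₂ : ℝ → X} (hT1 : T ≤ 1)
    (hp : MemLp p 2 (timeMeasure T)) (hη : 0 ≤ η) (hpη : ∫ s in Ioc 0 T, p s ^ 2 ≤ η ^ 2)
    (hKη : D.gain * η ≤ 1 / 2) (h₁ : D.IsMild T z₀ p z₁) (h₂ : D.IsMild T z₀ p z₂) :
    EqOn z₁ z₂ (Icc 0 T) := by
  intro t ht
  have hc := h₁.continuousOn.sub h₂.continuousOn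
  obtain ⟨r, hr, hmax⟩ := isCompact_Icc.exists_isMaxOn ⟨t, ht⟩ hc.norm
  -- At a point `r` where the difference is largest, the a priori estimate bounds that maximum by
  -- half of itself.
  have h := norm_le_add (D := D) (z := z₁ - z₂) (m := ‖(z₁ - z₂) r‖) hr.1 (hr.2.trans hT1) hr.2 hp
    hc (fun s hs => hmax ⟨hs.1, hs.2.trans hr.2⟩) hη hpη (x := z₁ r - z₂ r) (y := z₀ - z₀)
    fun k => coord_sub hr.1 hr.2 hp h₁.continuousOn h₂.continuousOn (h₁.coord r hr k)
      (h₂.coord r hr k)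
  have h0 : ‖(z₁ - z₂) t‖ ≤ ‖(z₁ - z₂) r‖ := hmax ht
  simp only [Pi.sub_apply, sub_self, norm_zero, zero_add] at h h0
  have h1 : ‖z₁ r - z₂ r‖ ≤ 0 := by nlinarith [norm_nonneg (z₁ r - z₂ r)]
  exact sub_eq_zero.mp (norm_eq_zero.mp (le_antisymm (h0.trans h1) (norm_nonneg _)))

variable (D) in
/-- Existence of mild solutions for small controls. -/
lemma exists_isMild [CompleteSpace X] {η : ℝ} {p : ℝ → ℝ} (z₀ : X)
    (hp : MemLp p 2 (timeMeasure 1)) (hη : 0 ≤ η) (hpη : ∫ s in Ioc 0 1, p s ^ 2 ≤ η ^ 2)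
    (hKη : D.gain * η ≤ 1 / 2) : ∃ z, D.IsMild 1 z₀ p z := by
  -- Elements of `C([0,1], X)` are extended by constants, so that they can enter integrals over the
  -- real line.
  let E : C(Icc (0 : ℝ) 1, X) → ℝ → X := fun z => IccExtend zero_le_one z
  have hE : ∀ z, Continuous (E z) := fun z => z.continuous.Icc_extend'
  have hex : ∀ z : C(Icc (0 : ℝ) 1, X), ∃ Z : C(Icc (0 : ℝ) 1, X), ∀ t k,
      ⟪D.φ k, Z t⟫_ℝ = Real.exp (-(D.μ k) * t) * ⟪D.φ k, z₀⟫_ℝ -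
        √(D.w k) * duhamel (D.μ k) (fun s => p s * ⟪D.φ k, D.b (E z s)⟫_ℝ) t := by
    intro z
    obtain ⟨Z, hZ, hZk⟩ := D.exists_duhamel z₀
      (memLp_source (D := D) hp (hE z).continuousOn)
    refine ⟨⟨(Icc 0 1).domRestrict Z, hZ.domRestrict⟩, fun t k => ?_⟩
    rw [← inner_source]
    exact hZk t t.2 k
  choose F hF using hex
  have hlip : ContractingWith (1 / 2) F := by
    refine ⟨by norm_num, LipschitzWith.of_dist_le_mul fun z₁ z₂ => ?_⟩
    rw [ContinuousMap.dist_le (by positivity)]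
    intro t
    -- Two images share the initial state, so only the Duhamel term remains, with factor `D.gain * η
    -- ≤ 1 / 2`.
    have h := norm_le_add (D := D) (z := fun s => E z₁ s - E z₂ s) (m := dist z₁ z₂) t.2.1 t.2.2
      t.2.2 hp ((hE z₁).sub (hE z₂)).continuousOn (fun s _ => ?_) hη hpη
      (x := F z₁ t - F z₂ t) (y := z₀ - z₀) fun k => coord_sub t.2.1 t.2.2 hp
        (hE z₁).continuousOn (hE z₂).continuousOn (hF z₁ t k) (hF z₂ t k)
    · rw [dist_eq_norm]
      refine h.trans ?_
      rw [sub_self, norm_zero, zero_add]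
      push_cast
      gcongr
    · rw [← dist_eq_norm]
      exact ContinuousMap.dist_apply_le_dist _
  have hfix := hlip.fixedPoint_isFixedPt
  set z := hlip.fixedPoint F
  refine ⟨E z, (hE z).continuousOn, fun t ht k => ?_⟩
  have h1 : E z t = F z ⟨t, ht⟩ := by
    rw [hfix]
    exact IccExtend_of_mem _ _ ht
  rw [h1]
  exact hF z ⟨t, ht⟩ k

end DiagonalSystem

end ParabolicControl

/-! ### Concatenation of controls and trajectories, and reachability. -/

namespace ParabolicControl

section Controls

lemma memLp_comp_sub {q : ℝ → ℝ} {t : ℝ} (r : ℝ) (hq : MemLp q 2 (timeMeasure t)) :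
    MemLp (fun s => q (s - r)) 2 (volume.restrict (Ioc r (r + t))) := by
  have h := (measurePreserving_sub_right (volume : Measure ℝ) r).restrict_preimage
    (measurableSet_Ioc (a := (0 : ℝ)) (b := t))
  have h2 : (fun s => s - r) ⁻¹' Ioc 0 t = Ioc r (r + t) := by
    ext s
    simp only [mem_preimage, mem_Ioc]
    constructor <;> rintro ⟨h1, h2⟩ <;> constructor <;> linarith
  rw [h2] at h
  exact hq.comp_measurePreserving h

/-- `f` up to time `r`, followed by `g` restarted at time `r`. -/
noncomputable def append {E : Type*} (r : ℝ) (f g : ℝ → E) : ℝ → E :=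
  (Iic r).piecewise f fun s => g (s - r)

lemma append_of_le {E : Type*} {r s : ℝ} {f g : ℝ → E} (h : s ≤ r) : append r f g s = f s :=
  piecewise_eq_of_mem _ _ _ h

lemma append_add {E : Type*} {r s : ℝ} {f g : ℝ → E} (h : 0 < s) :
    append r f g (r + s) = g s := by
  rw [append, piecewise_eq_of_notMem _ _ _ (by simpa using h), add_sub_cancel_left]

lemma memLp_append {p q : ℝ → ℝ} {r t : ℝ} (hp : MemLp p 2 (timeMeasure r))
    (hq : MemLp q 2 (timeMeasure t)) : MemLp (append r p q) 2 (timeMeasure (r + t)) := by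
  refine MemLp.piecewise measurableSet_Iic ?_ ?_
  · refine hp.mono_measure ?_
    rw [timeMeasure, Measure.restrict_restrict measurableSet_Iic]
    have h : Iic r ∩ Ioc 0 (r + t) ⊆ Ioc 0 r := fun s hs => ⟨hs.2.1, hs.1⟩
    exact Measure.restrict_mono h le_rfl
  · refine (memLp_comp_sub r hq).mono_measure ?_
    rw [timeMeasure, Measure.restrict_restrict measurableSet_Iic.compl]
    have h : (Iic r)ᶜ ∩ Ioc 0 (r + t) ⊆ Ioc r (r + t) := fun s hs => ⟨not_le.mp hs.1, hs.2.2⟩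
    exact Measure.restrict_mono h le_rfl

/-- Square integrable controls on the consecutive intervals `(σ j, σ (j + 1)]`, of summable
energies, can be glued to one square integrable control. -/
lemma exists_glued_control {σ : ℕ → ℝ} (hσ : Monotone σ) {p : ℕ → ℝ → ℝ}
    (hp : ∀ j, MemLp (p j) 2 (timeMeasure (σ (j + 1) - σ j))) {a : ℕ → ℝ} {A : ℝ}
    (ha : HasSum a A) (hpa : ∀ j, ∫ s in Ioc 0 (σ (j + 1) - σ j), p j s ^ 2 ≤ a j) (T : ℝ) :
    ∃ q : ℝ → ℝ, MemLp q 2 (timeMeasure T) ∧ ∫ s in Ioc 0 T, q s ^ 2 ≤ A ∧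
      ∀ j, ∀ s ∈ Ioc 0 (σ (j + 1) - σ j), q (σ j + s) = p j s := by
  set I : ℕ → Set ℝ := fun j => Ioc (σ j) (σ (j + 1)) with hI
  have hdisj : Pairwise (Function.onFun Disjoint I) := hσ.pairwise_disjoint_on_Ioc_succ
  -- The intervals are disjoint, so at most one term of the sum is nonzero at each time.
  set q : ℝ → ℝ := fun t => ∑' j, (I j).indicator (fun t => p j (t - σ j)) t with hq
  have hqI : ∀ j, ∀ t ∈ I j, q t = p j (t - σ j) := by
    intro j t ht
    rw [hq]
    simp only
    rw [tsum_eq_single j]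
    · exact indicator_of_mem ht _
    · intro i hi
      exact indicator_of_notMem (fun h => Set.disjoint_left.mp (hdisj hi) h ht) _
  have hq0 : ∀ t, t ∉ (⋃ j, I j) → q t = 0 := by
    intro t ht
    rw [hq]
    simp only
    rw [mem_iUnion, not_exists] at ht
    simp [ht]
  have hpI : ∀ j, MemLp q 2 (volume.restrict (I j)) := by
    intro j
    have h := memLp_comp_sub (σ j) (hp j)
    rw [add_sub_cancel] at h
    refine h.ae_eq ?_
    exact (ae_restrict_iff' measurableSet_Ioc).mpr (ae_of_all _ fun t ht => (hqI j t ht).symm)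
  have hE : ∀ j, ∫ t in I j, q t ^ 2 ≤ a j := by
    intro j
    refine le_trans (le_of_eq ?_) (hpa j)
    rw [setIntegral_congr_fun (g := fun t => p j (t - σ j) ^ 2) measurableSet_Ioc
      (fun t ht => by simp only [hqI j t ht])]
    rw [← intervalIntegral.integral_of_le (hσ (Nat.le_succ j)),
      ← intervalIntegral.integral_of_le (sub_nonneg.mpr (hσ (Nat.le_succ j))),
      intervalIntegral.integral_comp_sub_right (fun t => p j t ^ 2), sub_self]
  have hm : AEStronglyMeasurable q (volume.restrict (⋃ j, I j)) :=
    aestronglyMeasurable_iUnion_iff.mpr fun j => (hpI j).1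
  have hint : IntegrableOn (fun t => q t ^ 2) (⋃ j, I j) := by
    refine integrableOn_iUnion_of_summable_integral_norm (fun j => (hpI j).integrable_sq) ?_
    refine ha.summable.of_nonneg_of_le (fun j => integral_nonneg fun t => norm_nonneg _)
      fun j => ?_
    simpa using hE j
  have hU : MeasurableSet (⋃ j, I j) := MeasurableSet.iUnion fun j => measurableSet_Ioc
  have hsum := hasSum_integral_iUnion (fun j => measurableSet_Ioc) hdisj hint
  have hqU : (⋃ j, I j).indicator q = q := by
    funext t
    by_cases ht : t ∈ ⋃ j, I j
    · exact indicator_of_mem ht _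
    · rw [indicator_of_notMem ht, hq0 t ht]
  have hL : MemLp q 2 volume := by
    rw [← hqU, memLp_indicator_iff_restrict hU]
    exact (memLp_two_iff_integrable_sq hm).mpr hint
  refine ⟨q, hL.restrict _, ?_, fun j s hs => ?_⟩
  · calc ∫ s in Ioc 0 T, q s ^ 2 ≤ ∫ s, q s ^ 2 :=
          setIntegral_le_integral hL.integrable_sq (ae_of_all _ fun s => sq_nonneg _)
      _ = ∫ s in ⋃ j, I j, q s ^ 2 := by
        refine (setIntegral_eq_integral_of_forall_compl_eq_zero fun t ht => ?_).symm
        rw [hq0 t ht]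
        norm_num
      _ ≤ A := hasSum_le hE hsum ha
  · rw [hqI j (σ j + s) ⟨by linarith [hs.1], by linarith [hs.2]⟩, add_sub_cancel_left]

end Controls

namespace DiagonalSystem

variable {X : Type*} [NormedAddCommGroup X] [InnerProductSpace ℝ X] {D : DiagonalSystem X}

lemma IsMild.mono {T T' : ℝ} {p : ℝ → ℝ} {z₀ : X} {z : ℝ → X} (h : D.IsMild T z₀ p z)
    (hT : T' ≤ T) : D.IsMild T' z₀ p z :=
  ⟨h.continuousOn.mono (Icc_subset_Icc_right hT), fun t ht k => h.coord t ⟨ht.1, ht.2.trans hT⟩ k⟩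

lemma IsMild.congr {T : ℝ} {p q : ℝ → ℝ} {z₀ : X} {z : ℝ → X} (h : D.IsMild T z₀ p z)
    (hpq : ∀ s ∈ Ioc 0 T, p s = q s) : D.IsMild T z₀ q z := by
  refine ⟨h.continuousOn, fun t ht k => ?_⟩
  rw [h.coord t ht k]
  congr 2
  refine duhamel_congr ht.1 fun s hs => ?_
  rw [hpq s ⟨hs.1, hs.2.trans ht.2⟩]

lemma IsMild.apply_zero {T : ℝ} {p : ℝ → ℝ} {z₀ : X} {z : ℝ → X} (h : D.IsMild T z₀ p z)
    (hT : 0 ≤ T) : z 0 = z₀ := by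
  refine ext_coord D.φ fun k => ?_
  rw [h.coord 0 ⟨le_rfl, hT⟩ k, duhamel_zero]
  simp

lemma IsMild.shift {T r : ℝ} {p : ℝ → ℝ} {z₀ : X} {z : ℝ → X} (h : D.IsMild T z₀ p z)
    (hp : MemLp p 2 (timeMeasure T)) (hr : 0 ≤ r) (hrT : r ≤ T) :
    D.IsMild (T - r) (z r) (fun s => p (r + s)) (fun s => z (r + s)) := by
  refine ⟨?_, fun t ht k => ?_⟩
  · refine h.continuousOn.comp (by fun_prop) fun s hs => ?_
    exact ⟨by linarith [hs.1], by linarith [hs.2]⟩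
  · have hi := (integrableOn_source (D := D) hp h.continuousOn k).mono_set
      (Ioc_subset_Ioc_right (by linarith [ht.2] : r + t ≤ T))
    rw [h.coord (r + t) ⟨by linarith [ht.1], by linarith [ht.2]⟩ k, h.coord r ⟨hr, hrT⟩ k,
      duhamel_add_time hr ht.1 hi,
      show -(D.μ k) * (r + t) = -(D.μ k) * t + -(D.μ k) * r by ring, Real.exp_add]
    ring

lemma IsMild.append {r t : ℝ} {p q : ℝ → ℝ} {z₀ : X} {z y : ℝ → X} (hr : 0 ≤ r) (ht : 0 ≤ t)
    (hp : MemLp p 2 (timeMeasure r)) (hq : MemLp q 2 (timeMeasure t))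
    (h₁ : D.IsMild r z₀ p z) (h₂ : D.IsMild t (z r) q y) :
    D.IsMild (r + t) z₀ (append r p q) (ParabolicControl.append r z y) := by
  have hy0 : y 0 = z r := h₂.apply_zero ht
  have hge : ∀ s, 0 ≤ s → ParabolicControl.append r z y (r + s) = y s := by
    intro s hs
    rcases hs.eq_or_lt with rfl | hs
    · rw [add_zero, append_of_le le_rfl, hy0]
    · exact append_add hs
  have hc : ContinuousOn (ParabolicControl.append r z y) (Icc 0 (r + t)) := by
    rw [← Icc_union_Icc_eq_Icc hr (by linarith : r ≤ r + t)]
    refine ContinuousOn.union_of_isClosed ?_ ?_ isClosed_Icc isClosed_Icc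
    · exact h₁.continuousOn.congr fun s hs => append_of_le hs.2
    · have h3 : ContinuousOn (fun s => y (s - r)) (Icc r (r + t)) :=
        h₂.continuousOn.comp (by fun_prop) fun s hs => ⟨by linarith [hs.1], by linarith [hs.2]⟩
      refine h3.congr fun s hs => ?_
      have := hge (s - r) (by linarith [hs.1])
      rwa [add_sub_cancel] at this
  have hpq := memLp_append hp hq
  refine ⟨hc, fun s hs k => ?_⟩
  have hle : ∀ s ∈ Icc 0 r, ⟪D.φ k, ParabolicControl.append r z y s⟫_ℝ =
      Real.exp (-(D.μ k) * s) * ⟪D.φ k, z₀⟫_ℝ - √(D.w k) * duhamel (D.μ k) (fun s =>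
        ParabolicControl.append r p q s *
          ⟪D.φ k, D.b (ParabolicControl.append r z y s)⟫_ℝ) s := by
    intro s hs
    rw [append_of_le hs.2, h₁.coord s hs k]
    congr 2
    refine duhamel_congr hs.1 fun s' hs' => ?_
    rw [append_of_le (hs'.2.trans hs.2), append_of_le (hs'.2.trans hs.2)]
  rcases le_total s r with hsr | hsr
  · exact hle s ⟨hs.1, hsr⟩
  · obtain ⟨s, rfl⟩ : ∃ s', s = r + s' := ⟨s - r, by ring⟩
    have hs0 : 0 ≤ s := by linarith
    have hi := (integrableOn_source (D := D) hpq hc k).mono_set (Ioc_subset_Ioc_right hs.2)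
    have h4 := hle r ⟨hr, le_rfl⟩
    rw [append_of_le le_rfl] at h4
    have h5 : duhamel (D.μ k) (fun s' => ParabolicControl.append r p q (r + s') *
        ⟪D.φ k, D.b (ParabolicControl.append r z y (r + s'))⟫_ℝ) s =
        duhamel (D.μ k) (fun s' => q s' * ⟪D.φ k, D.b (y s')⟫_ℝ) s :=
      duhamel_congr hs0 fun s' hs' => by rw [append_add hs'.1, append_add hs'.1]
    rw [hge s hs0, h₂.coord s ⟨hs0, by linarith [hs.2]⟩ k, duhamel_add_time hr hs0 hi, h4, h5,
      show -(D.μ k) * (r + s) = -(D.μ k) * s + -(D.μ k) * r by ring, Real.exp_add]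
    ring

variable (D)

/-- Some control drives the system from `z₀` to `z₁` in time `T`. -/
def Reach (T : ℝ) (z₀ z₁ : X) : Prop :=
  ∃ p : ℝ → ℝ, MemLp p 2 (timeMeasure T) ∧ ∃ z : ℝ → X, D.IsMild T z₀ p z ∧ z T = z₁

/-- The stationary state of the uncontrolled system, normalized in `X`. -/
noncomputable def ground : X := √D.c • D.φ 0

lemma coord_ground (k : ℕ) : ⟪D.φ k, D.ground⟫_ℝ = if k = 0 then √D.c else 0 := by
  rw [ground, inner_smul_right, coord_basis]
  split_ifs <;> simp

lemma exp_mul_coord_ground (k : ℕ) (t : ℝ) :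
    Real.exp (-(D.μ k) * t) * ⟪D.φ k, D.ground⟫_ℝ = ⟪D.φ k, D.ground⟫_ℝ := by
  rw [coord_ground]
  split_ifs with h
  · rw [h, D.μ_zero]
    simp
  · simp

variable {D}

lemma Reach.trans {r t : ℝ} {x y z : X} (hr : 0 ≤ r) (ht : 0 ≤ t) (h₁ : D.Reach r x y)
    (h₂ : D.Reach t y z) : D.Reach (r + t) x z := by
  obtain ⟨p, hp, u, hu, hur⟩ := h₁
  obtain ⟨q, hq, v, hv, hvt⟩ := h₂
  rw [← hur] at hv
  refine ⟨_, memLp_append hp hq, _, hu.append hr ht hp hq hv, ?_⟩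
  rcases ht.eq_or_lt with rfl | ht
  · rw [add_zero, append_of_le le_rfl, ← hv.apply_zero le_rfl, hvt]
  · rw [append_add ht, hvt]

/-- The equation is linear in the state, so the same control serves the rescaled trajectory. This
carries the local result to all positive multiples of the ground state. -/
lemma Reach.smul {T : ℝ} {x y : X} (a : ℝ) (h : D.Reach T x y) : D.Reach T (a • x) (a • y) := by
  obtain ⟨p, hp, u, hu, huT⟩ := h
  refine ⟨p, hp, fun t => a • u t, ⟨hu.continuousOn.const_smul a, fun t ht k => ?_⟩,
    by simp only [huT]⟩
  have h1 : (fun s => p s * ⟪D.φ k, D.b (a • u s)⟫_ℝ) =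
      fun s => a * (p s * ⟪D.φ k, D.b (u s)⟫_ℝ) := by
    funext s
    rw [map_smul, inner_smul_right]
    ring
  rw [h1, duhamel_const_mul, inner_smul_right, inner_smul_right, hu.coord t ht k]
  ring

lemma reach_of_free {T : ℝ} (hT : 0 ≤ T) {x y : X}
    (h : ∀ k, ⟪D.φ k, y⟫_ℝ = Real.exp (-(D.μ k) * T) * ⟪D.φ k, x⟫_ℝ) : D.Reach T x y := by
  have hex : ∀ t : ℝ, ∃ z : X, 0 ≤ t →
      ∀ k, ⟪D.φ k, z⟫_ℝ = Real.exp (-(D.μ k) * t) * ⟪D.φ k, x⟫_ℝ := by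
    intro t
    by_cases ht : 0 ≤ t
    · obtain ⟨z, hz, -⟩ := D.exists_flow x ht
      exact ⟨z, fun _ => hz⟩
    · exact ⟨0, fun h => absurd h ht⟩
  choose z hz using hex
  refine ⟨fun _ => 0, MemLp.zero, z, ⟨?_, fun t ht k => ?_⟩, ?_⟩
  · refine continuousOn_of_coord D.φ (hasSum_sq_coord D.φ x).summable (fun t ht k => ?_)
      fun k => ?_
    · rw [hz t ht.1 k]
      exact sq_le_sq.mpr (abs_exp_mul_le k ht.1 _)
    · have h1 : ContinuousOn (fun t => Real.exp (-(D.μ k) * t) * ⟪D.φ k, x⟫_ℝ) (Icc 0 T) := by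
        fun_prop
      exact h1.congr fun t ht => hz t ht.1 k
  · rw [hz t ht.1 k]
    simp [duhamel]
  · exact ext_coord D.φ fun k => by rw [hz T hT k, h k]

lemma reach_ground {T : ℝ} (hT : 0 ≤ T) (D : DiagonalSystem X) : D.Reach T D.ground D.ground :=
  reach_of_free hT fun k => (D.exp_mul_coord_ground k T).symm

end DiagonalSystem
end ParabolicControl

/-! ### Local exact controllability by quadratic iteration. -/

namespace ParabolicControl

namespace DiagonalSystem

variable {X : Type*} [NormedAddCommGroup X] [InnerProductSpace ℝ X]

/-- Null controllability, in every small time `τ`, of the system linearized at the ground state,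
at a cost of at most `M e^{ν/τ}`. -/
def NullControllable (D : DiagonalSystem X) (M ν θ : ℝ) : Prop :=
  ∀ τ : ℝ, 0 < τ → τ ≤ θ → ∀ v : X, ∃ p : ℝ → ℝ, MemLp p 2 (timeMeasure τ) ∧
    ∫ s in Ioc 0 τ, p s ^ 2 ≤ (M * Real.exp (ν / τ) * ‖v‖) ^ 2 ∧
    ∀ k, Real.exp (-(D.μ k) * τ) * ⟪D.φ k, v⟫_ℝ =
      √(D.w k) * duhamel (D.μ k) (fun s => p s * ⟪D.φ k, D.b D.ground⟫_ℝ) τ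

variable {D : DiagonalSystem X}

lemma memLp_indicator_timeMeasure {p : ℝ → ℝ} {τ : ℝ} (T : ℝ) (hp : MemLp p 2 (timeMeasure τ)) :
    MemLp ((Ioc 0 τ).indicator p) 2 (timeMeasure T) :=
  ((memLp_indicator_iff_restrict measurableSet_Ioc).mpr hp).restrict _

lemma integral_indicator_sq {p : ℝ → ℝ} {τ T : ℝ} (hτ : τ ≤ T) :
    ∫ s in Ioc 0 T, (Ioc 0 τ).indicator p s ^ 2 = ∫ s in Ioc 0 τ, p s ^ 2 := by
  have h : (fun s => (Ioc 0 τ).indicator p s ^ 2) = (Ioc 0 τ).indicator fun s => p s ^ 2 := by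
    funext s
    by_cases hs : s ∈ Ioc 0 τ <;> simp [hs]
  rw [h, setIntegral_indicator measurableSet_Ioc,
    inter_eq_right.mpr (Ioc_subset_Ioc_right hτ)]

/-- One step of the iteration: the linear null control, used in the bilinear system, squares the
distance to the ground state. -/
lemma exists_quadratic_step [CompleteSpace X] {M ν θ τ : ℝ} (hM : 0 ≤ M) (hν : 0 ≤ ν)
    (hN : D.NullControllable M ν θ) (hτ : 0 < τ) (hτθ : τ ≤ θ) (hτ1 : τ ≤ 1) (v : X)
    (hv : D.gain * (M * Real.exp (ν / τ) * ‖v‖) ≤ 1 / 2) :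
    ∃ (p : ℝ → ℝ) (v' : X), MemLp p 2 (timeMeasure τ) ∧
      ∫ s in Ioc 0 τ, p s ^ 2 ≤ (M * Real.exp (ν / τ) * ‖v‖) ^ 2 ∧
      ‖v'‖ ≤ D.gain * M * (2 + 2 * D.gain * ‖D.ground‖ * M) * (Real.exp (ν / τ) * ‖v‖) ^ 2 ∧
      ∃ z, D.IsMild τ (D.ground + v) p z ∧ z τ = D.ground + v' := by
  obtain ⟨p, hp, hpv, hpk⟩ := hN τ hτ hτθ v
  set e := Real.exp (ν / τ) with he
  have he1 : 1 ≤ e := Real.one_le_exp (by positivity)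
  set η := M * e * ‖v‖ with hη
  have hη0 : 0 ≤ η := by positivity
  -- Existence is available on `[0, 1]`, so the control is extended by zero after `τ`.
  obtain ⟨z, hz1⟩ := D.exists_isMild (D.ground + v) (memLp_indicator_timeMeasure 1 hp) hη0
    ((integral_indicator_sq hτ1).trans_le hpv) hv
  have hz : D.IsMild τ (D.ground + v) p z :=
    (hz1.mono hτ1).congr fun s hs => indicator_of_mem hs p
  have hK := D.gain_nonneg
  have hd : ContinuousOn (fun t => z t - D.ground) (Icc 0 τ) :=
    hz.continuousOn.sub continuousOn_const
  obtain ⟨r, hr, hmax⟩ := isCompact_Icc.exists_isMaxOn ⟨0, le_rfl, hτ.le⟩ hd.norm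
  set m := ‖z r - D.ground‖ with hm
  have hdm : ∀ s ∈ Icc 0 τ, ‖z s - D.ground‖ ≤ m := fun s hs => hmax hs
  have hm0 : 0 ≤ m := norm_nonneg _
  have hbound : m ≤ ‖v‖ + D.gain * η * (‖D.ground‖ + m) := by
    refine norm_le_add (D := D) hr.1 (hr.2.trans hτ1) hr.2 hp hz.continuousOn (fun s hs => ?_)
      hη0 hpv fun k => ?_
    · calc ‖z s‖ = ‖D.ground + (z s - D.ground)‖ := by rw [add_sub_cancel]
        _ ≤ ‖D.ground‖ + ‖z s - D.ground‖ := norm_add_le _ _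
        _ ≤ _ := by
          gcongr
          exact hdm s ⟨hs.1, hs.2.trans hr.2⟩
    · rw [inner_sub_right, hz.coord r hr k, inner_add_right, mul_add, exp_mul_coord_ground]
      ring
  have hmle : m ≤ (2 + 2 * D.gain * ‖D.ground‖ * M) * (e * ‖v‖) := by
    -- Since `D.gain * η ≤ 1 / 2`, the term in `m` on the right of `hbound` is absorbed.
    have h1 : m ≤ 2 * ‖v‖ + 2 * (D.gain * η) * ‖D.ground‖ := by nlinarith
    have h2 : ‖v‖ ≤ e * ‖v‖ := le_mul_of_one_le_left (norm_nonneg _) he1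
    calc m ≤ 2 * ‖v‖ + 2 * (D.gain * η) * ‖D.ground‖ := h1
      _ ≤ 2 * (e * ‖v‖) + 2 * (D.gain * η) * ‖D.ground‖ := by gcongr
      _ = _ := by
        rw [hη]
        ring
  have hτmem : τ ∈ Icc 0 τ := ⟨hτ.le, le_rfl⟩
  refine ⟨p, z τ - D.ground, hp, hpv, ?_, z, hz, (add_sub_cancel _ _).symm⟩
  -- The control cancels the linear part exactly at time `τ`. What is left is the Duhamel term of `p
  -- * b (z - ground)`, a product of two quantities of order `e * ‖v‖`.
  have hfin : ‖z τ - D.ground‖ ≤ ‖(0 : X)‖ + D.gain * η * m := by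
    refine norm_le_add (D := D) hτ.le hτ1 le_rfl hp hd hdm hη0 hpv fun k => ?_
    have h1 := integrableOn_source (D := D) hp hz.continuousOn k
    have h2 := integrableOn_source (D := D) hp
      (continuousOn_const : ContinuousOn (fun _ => D.ground) (Icc 0 τ)) k
    have h3 : (fun s => p s * ⟪D.φ k, D.b (z s - D.ground)⟫_ℝ) =
        fun s => p s * ⟪D.φ k, D.b (z s)⟫_ℝ - p s * ⟪D.φ k, D.b D.ground⟫_ℝ := by
      funext s
      rw [map_sub, inner_sub_right, mul_sub]
    rw [h3, duhamel_sub hτ.le h1 h2, inner_sub_right, hz.coord τ hτmem k, inner_add_right,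
      mul_add, exp_mul_coord_ground, mul_sub, ← hpk k, inner_zero_right]
    ring
  calc _ ≤ _ := hfin
    _ = D.gain * η * m := by rw [norm_zero, zero_add]
    _ ≤ D.gain * η * ((2 + 2 * D.gain * ‖D.ground‖ * M) * (e * ‖v‖)) := by gcongr
    _ = _ := by
      rw [hη]
      ring

/-- The rate at which the iteration converges. -/
lemma exists_rate {N C M η : ℝ} (hη : 0 < η) (hM : 0 ≤ M) :
    ∃ α : ℝ, 1 ≤ α ∧ ∀ j : ℕ,
      (M * Real.exp (N * ((j + 1) * (j + 2))) * Real.exp (-α * (j + 4) ^ 2)) ^ 2 ≤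
        η ^ 2 / 2 / 2 ^ j ∧
      C * (Real.exp (N * ((j + 1) * (j + 2))) * Real.exp (-α * (j + 4) ^ 2)) ^ 2 ≤
        Real.exp (-α * ((j + 1 : ℕ) + 4) ^ 2) := by
  have h1 := Real.tendsto_exp_atTop.eventually_ge_atTop C
  have h2 := Real.tendsto_exp_atTop.eventually_ge_atTop (M / η)
  -- The rate must dominate the cost exponent (`2 * N ≤ α`), and `e^α` must absorb the constants `C`
  -- and `M / η`.
  obtain ⟨α, hα1, hα2, hα3, hα4⟩ := (((eventually_ge_atTop (1 : ℝ)).and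
    ((eventually_ge_atTop (2 * N)).and (h1.and h2)))).exists
  refine ⟨α, hα1, fun j => ?_⟩
  have hj : (0 : ℝ) ≤ j := Nat.cast_nonneg j
  have hMη : M ≤ η * Real.exp α := by
    rw [div_le_iff₀ hη] at hα4
    linarith
  constructor
  · have h3 : M * Real.exp (N * ((j + 1) * (j + 2))) * Real.exp (-α * (j + 4) ^ 2) ≤
        η * Real.exp (-((j : ℝ) + 1)) := by
      calc _ ≤ η * Real.exp α * Real.exp (N * ((j + 1) * (j + 2))) *
            Real.exp (-α * (j + 4) ^ 2) := by gcongr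
        _ = η * Real.exp (α + N * ((j + 1) * (j + 2)) + -α * (j + 4) ^ 2) := by
          rw [Real.exp_add, Real.exp_add]
          ring
        _ ≤ _ := by
          gcongr
          have h5 : N * ((j + 1) * (j + 2)) ≤ α / 2 * ((j + 1) * (j + 2)) := by
            gcongr
            linarith
          have h6 : (j : ℝ) + 1 ≤ α * (j + 1) := le_mul_of_one_le_left (by positivity) hα1
          have h7 : 0 ≤ α * ((j : ℝ) ^ 2 + 12 * j) := by positivity
          nlinarith
    have h4 : Real.exp (-((j : ℝ) + 1)) ^ 2 ≤ 1 / 2 / 2 ^ j := by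
      have h5 : Real.exp (-((j : ℝ) + 1)) = Real.exp (-1) ^ (j + 1) := by
        rw [← Real.exp_nat_mul]
        push_cast
        ring_nf
      have h6 : Real.exp (-1) ≤ 1 / 2 := by
        rw [Real.exp_neg, inv_le_comm₀ (Real.exp_pos _) (by norm_num)]
        have := Real.add_one_le_exp 1
        norm_num
        linarith
      have h7 : Real.exp (-((j : ℝ) + 1)) ≤ 1 / 2 / 2 ^ j := by
        rw [h5]
        calc _ ≤ (1 / 2 : ℝ) ^ (j + 1) := by gcongr
          _ = _ := by
            rw [pow_succ, one_div, inv_pow]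
            ring
      have h8 : Real.exp (-((j : ℝ) + 1)) ≤ 1 := by
        rw [Real.exp_le_one_iff]
        linarith
      exact (pow_le_of_le_one (Real.exp_pos _).le h8 two_ne_zero).trans h7
    calc _ ≤ (η * Real.exp (-((j : ℝ) + 1))) ^ 2 := by gcongr
      _ = η ^ 2 * Real.exp (-((j : ℝ) + 1)) ^ 2 := by ring
      _ ≤ η ^ 2 * (1 / 2 / 2 ^ j) := by gcongr
      _ = _ := by ring
  · calc _ ≤ Real.exp α *
          (Real.exp (N * ((j + 1) * (j + 2))) * Real.exp (-α * (j + 4) ^ 2)) ^ 2 := by gcongr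
      _ = Real.exp (α + 2 * (N * ((j + 1) * (j + 2)) + -α * (j + 4) ^ 2)) := by
        rw [← Real.exp_add, ← Real.exp_nat_mul, Real.exp_add]
        norm_num
      _ ≤ _ := by
        gcongr
        push_cast
        have h5 : 2 * N * ((j + 1) * (j + 2)) ≤ α * ((j + 1) * (j + 2)) := by gcongr
        -- After division by `α` this is `1 + (j+1)(j+2) + (j+5)² ≤ 2(j+4)²`, which holds with
        -- margin `3j + 4`.
        nlinarith

/-- Local exact controllability to the ground state. -/
theorem exists_reach_ground [CompleteSpace X] {M ν θ : ℝ} (hM : 0 ≤ M) (hν : 0 ≤ ν) (hθ : 0 < θ)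
    (hθ1 : θ ≤ 1) (hN : D.NullControllable M ν θ) :
    ∃ δ : ℝ, 0 < δ ∧ ∀ v : X, ‖v‖ ≤ δ → D.Reach 1 (D.ground + v) D.ground := by
  have hK := D.gain_nonneg
  set η : ℝ := 1 / (2 * (D.gain + 1)) with hη
  have hη0 : 0 < η := by positivity
  have hKη : D.gain * η ≤ 1 / 2 := by
    rw [hη, mul_one_div, div_le_div_iff₀ (by positivity) two_pos]
    linarith
  set C := D.gain * M * (2 + 2 * D.gain * ‖D.ground‖ * M)
  have hC : 0 ≤ C := by positivity
  obtain ⟨α, hα1, hα⟩ := exists_rate (N := ν / θ) (C := C) hη0 hM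
  set N := ν / θ with hNdef
  set δ : ℕ → ℝ := fun j => Real.exp (-α * (j + 4) ^ 2) with hδ
  -- Telescoping times with limit `θ`, whose gaps make the cost exponent quadratic in `j`.
  set σ : ℕ → ℝ := fun j => θ - θ * (1 / ((j : ℝ) + 1)) with hσ
  have hστ : ∀ j, σ (j + 1) - σ j = θ / ((j + 1) * (j + 2)) := by
    intro j
    simp only [hσ]
    push_cast
    field_simp
    ring
  have hτpos : ∀ j, 0 < σ (j + 1) - σ j := fun j => by
    rw [hστ]
    positivity
  have hσmono : Monotone σ := monotone_nat_of_le_succ fun j => (sub_pos.mp (hτpos j)).le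
  have hσ0 : σ 0 = 0 := by simp [hσ]
  have hσnn : ∀ j, 0 ≤ σ j := fun j => hσ0 ▸ hσmono (Nat.zero_le j)
  have hσθ : ∀ j, σ j ≤ θ := fun j => by
    simp only [hσ]
    have : 0 ≤ θ * (1 / ((j : ℝ) + 1)) := by positivity
    linarith
  have hσlim : Tendsto σ atTop (𝓝 θ) := by
    have h := (tendsto_one_div_add_atTop_nhds_zero_nat (𝕜 := ℝ)).const_mul θ |>.const_sub θ
    simpa [hσ] using h
  have hexp : ∀ j, Real.exp (ν / (σ (j + 1) - σ j)) = Real.exp (N * ((j + 1) * (j + 2))) := by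
    intro j
    rw [hστ, hNdef]
    congr 1
    field_simp
  -- The bound on `v` stands inside the existential, with the value `0` when it fails, so that
  -- `choose` gives total maps that can be iterated.
  have hstep : ∀ (j : ℕ) (v : X), ∃ (p : ℝ → ℝ) (v' : X), ‖v‖ ≤ δ j →
      MemLp p 2 (timeMeasure (σ (j + 1) - σ j)) ∧
      ∫ s in Ioc 0 (σ (j + 1) - σ j), p s ^ 2 ≤ η ^ 2 / 2 / 2 ^ j ∧ ‖v'‖ ≤ δ (j + 1) ∧
      ∃ z, D.IsMild (σ (j + 1) - σ j) (D.ground + v) p z ∧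
        z (σ (j + 1) - σ j) = D.ground + v' := by
    intro j v
    by_cases hv : ‖v‖ ≤ δ j
    · have h1 : (M * Real.exp (ν / (σ (j + 1) - σ j)) * ‖v‖) ^ 2 ≤ η ^ 2 / 2 / 2 ^ j := by
        rw [hexp]
        refine le_trans ?_ (hα j).1
        gcongr
      have h2 : η ^ 2 / 2 / 2 ^ j ≤ η ^ 2 := by
        rw [div_div]
        refine div_le_self (sq_nonneg _) ?_
        have : (1 : ℝ) ≤ 2 ^ j := one_le_pow₀ (by norm_num)
        linarith
      have h3 : M * Real.exp (ν / (σ (j + 1) - σ j)) * ‖v‖ ≤ η :=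
        (sq_le_sq₀ (by positivity) hη0.le).mp (h1.trans h2)
      have hτθ : σ (j + 1) - σ j ≤ θ := by linarith [hσθ (j + 1), hσnn j]
      obtain ⟨p, v', hp, hpv, hv', hz⟩ := exists_quadratic_step hM hν hN (hτpos j) hτθ
        (hτθ.trans hθ1) v ((mul_le_mul_of_nonneg_left h3 hK).trans hKη)
      refine ⟨p, v', fun _ => ⟨hp, hpv.trans h1, hv'.trans ?_, hz⟩⟩
      rw [hexp]
      refine le_trans ?_ (hα j).2
      gcongr
    · exact ⟨0, 0, fun h => absurd h hv⟩
  choose P V hPV using hstep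
  refine ⟨δ 0, Real.exp_pos _, fun v₀ hv₀ => ?_⟩
  let v : ℕ → X := fun j => Nat.rec v₀ (fun j x => V j x) j
  have hv : ∀ j, ‖v j‖ ≤ δ j := by
    intro j
    induction j with
    | zero => exact hv₀
    | succ j ih => exact (hPV j (v j) ih).2.2.1
  obtain ⟨q, hq, hqη, hqP⟩ := exists_glued_control hσmono (fun j => (hPV j (v j) (hv j)).1)
    (hasSum_geometric_two' (η ^ 2)) (fun j => (hPV j (v j) (hv j)).2.1) 1
  obtain ⟨z, hz⟩ := D.exists_isMild (D.ground + v₀) hq hη0.le hqη hKη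
  -- On each interval the solution for the glued control solves the same problem as the trajectory
  -- of that step, and uniqueness identifies them.
  have hzσ : ∀ j, z (σ j) = D.ground + v j := by
    intro j
    induction j with
    | zero =>
      rw [hσ0]
      exact hz.apply_zero zero_le_one
    | succ j ih =>
      obtain ⟨hp, hpη, -, y, hy, hyτ⟩ := hPV j (v j) (hv j)
      have h1 := ((hz.shift hq (hσnn j) ((hσθ j).trans hθ1)).mono
        (sub_le_sub_right ((hσθ (j + 1)).trans hθ1) (σ j))).congr (hqP j)
      rw [ih] at h1
      have hpη' : ∫ s in Ioc 0 (σ (j + 1) - σ j), P j (v j) s ^ 2 ≤ η ^ 2 := by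
        refine hpη.trans ?_
        rw [div_div]
        refine div_le_self (sq_nonneg _) ?_
        have : (1 : ℝ) ≤ 2 ^ j := one_le_pow₀ (by norm_num)
        linarith
      have h2 := IsMild.eqOn (by linarith [hσθ (j + 1), hσnn j]) hp hη0.le hpη' hKη h1 hy
        ⟨(hτpos j).le, le_rfl⟩
      simp only [add_sub_cancel] at h2
      rw [h2, hyτ]
  have hvlim : Tendsto v atTop (𝓝 0) := by
    refine squeeze_zero_norm (a := fun j : ℕ => Real.exp (-(j : ℝ))) (fun j => (hv j).trans ?_) ?_
    · simp only [hδ]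
      gcongr
      have hj : (0 : ℝ) ≤ j := Nat.cast_nonneg j
      nlinarith
    · exact Real.tendsto_exp_neg_atTop_nhds_zero.comp tendsto_natCast_atTop_atTop
  have hzθ : z θ = D.ground := by
    have h1 : Tendsto (fun j => z (σ j)) atTop (𝓝 (z θ)) := by
      refine (hz.continuousOn θ ⟨hθ.le, hθ1⟩).tendsto.comp ?_
      exact tendsto_nhdsWithin_iff.mpr ⟨hσlim, Eventually.of_forall fun j =>
        ⟨hσnn j, (hσθ j).trans hθ1⟩⟩
    have h2 : Tendsto (fun j => z (σ j)) atTop (𝓝 D.ground) := by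
      simp only [hzσ]
      simpa using hvlim.const_add D.ground
    exact tendsto_nhds_unique h1 h2
  have h1 : D.Reach θ (D.ground + v₀) D.ground :=
    ⟨q, hq.mono_measure (Measure.restrict_mono (Ioc_subset_Ioc_right hθ1) le_rfl), z,
      hz.mono hθ1, hzθ⟩
  have h2 := h1.trans hθ.le (sub_nonneg.mpr hθ1) (reach_ground (sub_nonneg.mpr hθ1) D)
  rwa [add_sub_cancel] at h2

end DiagonalSystem
end ParabolicControl

/-! ### Passage between the original problem and the diagonal system. -/

namespace ParabolicControl

lemma exp_mul_duhamel (a m : ℝ) (f : ℝ → ℝ) (t : ℝ) :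
    Real.exp (a * t) * duhamel m f t = duhamel (m - a) (fun s => Real.exp (a * s) * f s) t := by
  rw [duhamel, duhamel, ← intervalIntegral.integral_const_mul]
  refine intervalIntegral.integral_congr fun s _ => ?_
  rw [← mul_assoc, ← mul_assoc, ← Real.exp_add, ← Real.exp_add]
  ring_nf

variable {X : Type*} [NormedAddCommGroup X] [InnerProductSpace ℝ X]

lemma IsEigenbasis.nonneg [CompleteSpace X] {A : X →ₗ.[ℝ] X} (hA : IsAdmissible A)
    {φ : HilbertBasis ℕ ℝ X} {lam : ℕ → ℝ} (hφ : IsEigenbasis A φ lam) (k : ℕ) : 0 ≤ lam k := by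
  obtain ⟨h, hk⟩ := hφ.eigen k
  have h1 := hA.accretive ⟨φ k, h⟩
  rw [hk, real_inner_smul_left, coord_basis] at h1
  simpa using h1

section Coordinates

variable {φ : HilbertBasis ℕ ℝ X} {lam : ℕ → ℝ}

lemma hasSum_of_coord (φ : HilbertBasis ℕ ℝ X) {c : ℕ → ℝ} {x : X} (hx : ∀ k, ⟪φ k, x⟫_ℝ = c k) :
    HasSum (fun k => c k • φ k) x := by
  have h := φ.hasSum_repr x
  simp only [φ.repr_apply_apply, hx] at h
  exact h

lemma coord_tsum (φ : HilbertBasis ℕ ℝ X) {c : ℕ → ℝ} (hc : Summable fun k => c k ^ 2) (k : ℕ) :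
    ⟪φ k, ∑' j, c j • φ j⟫_ℝ = c k := by
  obtain ⟨x, hx⟩ := exists_coord_eq φ hc
  rw [(hasSum_of_coord φ hx).tsum_eq, hx]

lemma summable_semigroup_coord (hlam : ∀ k, 0 ≤ lam k) {t : ℝ} (ht : 0 ≤ t) (x : X) :
    Summable fun k => (Real.exp (-(lam k) * t) * ⟪x, φ k⟫_ℝ) ^ 2 := by
  refine (hasSum_sq_coord φ x).summable.of_nonneg_of_le (fun k => sq_nonneg _) fun k => ?_
  rw [mul_pow, real_inner_comm]
  refine mul_le_of_le_one_left (sq_nonneg _) (pow_le_one₀ (Real.exp_pos _).le ?_)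
  rw [Real.exp_le_one_iff]
  nlinarith [hlam k]

lemma coord_semigroup (hlam : ∀ k, 0 ≤ lam k) {t : ℝ} (ht : 0 ≤ t) (x : X) (k : ℕ) :
    ⟪φ k, semigroup φ lam t x⟫_ℝ = Real.exp (-(lam k) * t) * ⟪φ k, x⟫_ℝ := by
  rw [semigroup, coord_tsum φ (summable_semigroup_coord hlam ht x), real_inner_comm]

lemma norm_semigroup_le (hlam : ∀ k, 0 ≤ lam k) {t : ℝ} (ht : 0 ≤ t) (x : X) :
    ‖semigroup φ lam t x‖ ≤ ‖x‖ := by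
  refine norm_le_of_abs_coord_le φ fun k => ?_
  rw [coord_semigroup hlam ht, abs_mul, abs_of_pos (Real.exp_pos _)]
  refine mul_le_of_le_one_left (abs_nonneg _) ?_
  rw [Real.exp_le_one_iff]
  nlinarith [hlam k]

/-- Measurability comes from the partial sums of the series, integrability from the contraction
property. -/
lemma integrableOn_semigroup (hlam : ∀ k, 0 ≤ lam k) {t : ℝ} {f : ℝ → X}
    (hf : IntegrableOn f (Ioc 0 t)) :
    IntegrableOn (fun s => semigroup φ lam (t - s) (f s)) (Ioc 0 t) := by
  refine Integrable.mono hf ?_ ?_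
  · refine aestronglyMeasurable_of_tendsto_ae atTop
      (f := fun n s => ∑ k ∈ Finset.range n,
        (Real.exp (-(lam k) * (t - s)) * ⟪f s, φ k⟫_ℝ) • φ k) (fun n => ?_) ?_
    · have h : ∀ k, AEStronglyMeasurable (fun s => ⟪f s, φ k⟫_ℝ) (volume.restrict (Ioc 0 t)) :=
        fun k => hf.1.inner aestronglyMeasurable_const
      refine Finset.aestronglyMeasurable_fun_sum _ fun k _ => ?_
      refine AEStronglyMeasurable.smul_const (AEStronglyMeasurable.mul ?_ (h k)) _
      exact Continuous.aestronglyMeasurable (by fun_prop)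
    · refine (ae_restrict_iff' measurableSet_Ioc).mpr (ae_of_all _ fun s hs => ?_)
      refine (hasSum_of_coord φ fun k => ?_).tendsto_sum_nat
      rw [coord_semigroup hlam (sub_nonneg.mpr hs.2), real_inner_comm]
  · refine (ae_restrict_iff' measurableSet_Ioc).mpr (ae_of_all _ fun s hs => ?_)
    exact norm_semigroup_le hlam (sub_nonneg.mpr hs.2) _

/-- Duhamel's formula in coordinates. -/
lemma coord_mild [CompleteSpace X] (hlam : ∀ k, 0 ≤ lam k) {t : ℝ} (ht : 0 ≤ t) {f : ℝ → X}
    (hf : IntegrableOn f (Ioc 0 t)) (y : X) (k : ℕ) :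
    ⟪φ k, semigroup φ lam t y - ∫ s in (0 : ℝ)..t, semigroup φ lam (t - s) (f s)⟫_ℝ =
      Real.exp (-(lam k) * t) * ⟪φ k, y⟫_ℝ - duhamel (lam k) (fun s => ⟪φ k, f s⟫_ℝ) t := by
  rw [inner_sub_right, coord_semigroup hlam ht, duhamel, intervalIntegral.integral_of_le ht,
    intervalIntegral.integral_of_le ht, ← integral_inner (integrableOn_semigroup hlam hf)]
  congr 1
  refine setIntegral_congr_fun measurableSet_Ioc fun s hs => ?_
  exact coord_semigroup hlam (sub_nonneg.mpr hs.2) _ _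

lemma mem_fracDomain_half {x : X} :
    x ∈ fracDomain φ lam (1 / 2) ↔ Summable fun k => lam k * ⟪φ k, x⟫_ℝ ^ 2 := by
  simp only [fracDomain, mem_ofPred_eq, sq_abs, real_inner_comm x]
  norm_num

/-- `y` represents `x ∈ D(A^{1/2})` in the sense that `y = (I + A)^{1/2} x`. -/
def IsLift (φ : HilbertBasis ℕ ℝ X) (lam : ℕ → ℝ) (x y : X) : Prop :=
  ∀ k, ⟪φ k, y⟫_ℝ = √(1 + lam k) * ⟪φ k, x⟫_ℝ

lemma IsLift.sub {x y x' y' : X} (h : IsLift φ lam x y) (h' : IsLift φ lam x' y') :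
    IsLift φ lam (x - x') (y - y') := fun k => by
  rw [inner_sub_right, inner_sub_right, h k, h' k, mul_sub]

lemma IsLift.add {x y x' y' : X} (h : IsLift φ lam x y) (h' : IsLift φ lam x' y') :
    IsLift φ lam (x + x') (y + y') := fun k => by
  rw [inner_add_right, inner_add_right, h k, h' k, mul_add]

lemma IsLift.smul {x y : X} (a : ℝ) (h : IsLift φ lam x y) :
    IsLift φ lam (a • x) (a • y) := fun k => by
  rw [inner_smul_right, inner_smul_right, h k]
  ring

lemma isLift_basis (φ : HilbertBasis ℕ ℝ X) (lam : ℕ → ℝ) (j : ℕ) :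
    IsLift φ lam (φ j) (√(1 + lam j) • φ j) := fun k => by
  rw [inner_smul_right, coord_basis]
  split_ifs with h
  · rw [h]
  · simp

lemma exists_isLift (hlam : ∀ k, 0 ≤ lam k) {x : X} (hx : x ∈ fracDomain φ lam (1 / 2)) :
    ∃ y, IsLift φ lam x y := by
  refine exists_coord_eq φ ?_
  refine ((hasSum_sq_coord φ x).summable.add (mem_fracDomain_half.mp hx)).congr fun k => ?_
  rw [mul_pow, Real.sq_sqrt (by linarith [hlam k])]
  ring

lemma exists_isLift_right (hlam : ∀ k, 0 ≤ lam k) (y : X) : ∃ x, IsLift φ lam x y := by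
  have h1 : ∀ k, 1 ≤ √(1 + lam k) := fun k => Real.one_le_sqrt.mpr (by linarith [hlam k])
  have hs : Summable fun k => (⟪φ k, y⟫_ℝ / √(1 + lam k)) ^ 2 := by
    refine (hasSum_sq_coord φ y).summable.of_nonneg_of_le (fun k => sq_nonneg _) fun k => ?_
    rw [div_pow]
    exact div_le_self (sq_nonneg _) (one_le_pow₀ (h1 k))
  obtain ⟨x, hx⟩ := exists_coord_eq φ hs
  refine ⟨x, fun k => ?_⟩
  rw [hx k, mul_div_cancel₀]
  linarith [h1 k]

lemma IsLift.mem_fracDomain (hlam : ∀ k, 0 ≤ lam k) {x y : X} (h : IsLift φ lam x y) :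
    x ∈ fracDomain φ lam (1 / 2) := by
  refine mem_fracDomain_half.mpr ?_
  refine (hasSum_sq_coord φ y).summable.of_nonneg_of_le
    (fun k => mul_nonneg (hlam k) (sq_nonneg _)) fun k => ?_
  rw [h k, mul_pow, Real.sq_sqrt (by linarith [hlam k])]
  nlinarith [sq_nonneg ⟪φ k, x⟫_ℝ]

lemma IsLift.norm_le (hlam : ∀ k, 0 ≤ lam k) {x y : X} (h : IsLift φ lam x y) : ‖x‖ ≤ ‖y‖ := by
  refine norm_le_of_abs_coord_le φ fun k => ?_
  rw [h k, abs_mul, abs_of_nonneg (Real.sqrt_nonneg _)]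
  exact le_mul_of_one_le_left (abs_nonneg _) (Real.one_le_sqrt.mpr (by linarith [hlam k]))

lemma IsLift.left_unique (hlam : ∀ k, 0 ≤ lam k) {x x' y : X} (h : IsLift φ lam x y)
    (h' : IsLift φ lam x' y) : x = x' := by
  have h1 := (h.sub h').norm_le hlam
  rw [sub_self, norm_zero] at h1
  exact sub_eq_zero.mp (norm_eq_zero.mp (le_antisymm h1 (norm_nonneg _)))

lemma coord_fracPow_half (hlam : ∀ k, 0 ≤ lam k) {x : X} (hx : x ∈ fracDomain φ lam (1 / 2))
    (k : ℕ) : ⟪φ k, fracPow φ lam (1 / 2) x⟫_ℝ = √(lam k) * ⟪φ k, x⟫_ℝ := by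
  have hs : Summable fun k => (lam k ^ (1 / 2 : ℝ) * ⟪x, φ k⟫_ℝ) ^ 2 := by
    refine (mem_fracDomain_half.mp hx).congr fun k => ?_
    rw [mul_pow, ← Real.sqrt_eq_rpow, Real.sq_sqrt (hlam k), real_inner_comm]
  rw [fracPow, coord_tsum φ hs, ← Real.sqrt_eq_rpow, real_inner_comm]

lemma IsLift.fracNorm_eq (hlam : ∀ k, 0 ≤ lam k) {x y : X} (h : IsLift φ lam x y) :
    fracNorm φ lam (1 / 2) x = ‖y‖ := by
  have hx := h.mem_fracDomain hlam
  have h1 := (hasSum_sq_coord φ x).add (hasSum_sq_coord φ (fracPow φ lam (1 / 2) x))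
  have h2 : (fun k => ⟪φ k, x⟫_ℝ ^ 2 + ⟪φ k, fracPow φ lam (1 / 2) x⟫_ℝ ^ 2) =
      fun k => ⟪φ k, y⟫_ℝ ^ 2 := by
    funext k
    rw [coord_fracPow_half hlam hx, h k, mul_pow, mul_pow, Real.sq_sqrt (hlam k),
      Real.sq_sqrt (by linarith [hlam k])]
    ring
  rw [h2] at h1
  rw [fracNorm, h1.unique (hasSum_sq_coord φ y), Real.sqrt_sq (norm_nonneg _)]

lemma fracInner_basis (hlam : ∀ k, 0 ≤ lam k) {x : X} (hx : x ∈ fracDomain φ lam (1 / 2))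
    (j : ℕ) : fracInner φ lam (1 / 2) x (φ j) = (1 + lam j) * ⟪φ j, x⟫_ℝ := by
  have hj : fracPow φ lam (1 / 2) (φ j) = √(lam j) • φ j := by
    refine ext_coord φ fun k => ?_
    rw [coord_fracPow_half hlam ((isLift_basis φ lam j).mem_fracDomain hlam), inner_smul_right,
      coord_basis]
    split_ifs with h
    · rw [h]
    · simp
  rw [fracInner, hj, inner_smul_right, real_inner_comm, real_inner_comm (φ j),
    coord_fracPow_half hlam hx, ← mul_assoc, Real.mul_self_sqrt (hlam j)]
  ring

/-- The operator `B (I + A)^{-1/2}` is bounded. -/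
lemma exists_lifted_operator (hlam : ∀ k, 0 ≤ lam k) {B : X →ₗ.[ℝ] X}
    (hB : HalfBounded φ lam B) :
    ∃ b : X →L[ℝ] X, ∀ x y, IsLift φ lam x y → b y = applyOp B x := by
  obtain ⟨C, hC, hBC⟩ := hB
  choose J hJ using exists_isLift_right (φ := φ) hlam
  have hdom : ∀ y, J y ∈ B.domain := fun y => (hBC _ ((hJ y).mem_fracDomain hlam)).1
  let b₀ : X →ₗ[ℝ] X :=
    { toFun := fun y => B ⟨J y, hdom y⟩
      map_add' := fun y y' => by
        rw [← B.map_add]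
        congr 1
        exact Subtype.ext ((hJ _).left_unique hlam ((hJ y).add (hJ y')))
      map_smul' := fun a y => by
        rw [RingHom.id_apply, ← B.map_smul]
        congr 1
        exact Subtype.ext ((hJ _).left_unique hlam ((hJ y).smul a)) }
  refine ⟨b₀.mkContinuous C fun y => ?_, fun x y hxy => ?_⟩
  · obtain ⟨_, h⟩ := hBC _ ((hJ y).mem_fracDomain hlam)
    rw [(hJ y).fracNorm_eq hlam] at h
    exact h
  · have h : J y = x := (hJ y).left_unique hlam hxy
    subst h
    rw [applyOp, dif_pos (hdom y)]
    rfl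

end Coordinates

section Transfer

/-- The diagonal form of the control system, in the moving frame of the ground state. -/
@[simps]
noncomputable def diagonalSystem (φ : HilbertBasis ℕ ℝ X) {lam : ℕ → ℝ} (hmono : Monotone lam)
    (hlam : ∀ k, 0 ≤ lam k) (b : X →L[ℝ] X) : DiagonalSystem X where
  φ := φ
  μ k := lam k - lam 0
  c := 1 + lam 0
  b := b
  μ_nonneg k := sub_nonneg.mpr (hmono (Nat.zero_le k))
  μ_zero := sub_self _
  one_le_c := by linarith [hlam 0]

variable {φ : HilbertBasis ℕ ℝ X} {lam : ℕ → ℝ} (hmono : Monotone lam) (hlam : ∀ k, 0 ≤ lam k)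
  {B : X →ₗ.[ℝ] X} {b : X →L[ℝ] X}

lemma diagonalSystem_w (k : ℕ) : (diagonalSystem φ hmono hlam b).w k = 1 + lam k := by
  simp [DiagonalSystem.w]

lemma diagonalSystem_ground :
    (diagonalSystem φ hmono hlam b).ground = √(1 + lam 0) • φ 0 := rfl

lemma controllableToGroundState_of_reach [CompleteSpace X]
    (hb : ∀ x y, IsLift φ lam x y → b y = applyOp B x) {T : ℝ} {u₀ z₀ : X}
    (hu : IsLift φ lam u₀ z₀)
    (h : (diagonalSystem φ hmono hlam b).Reach T z₀ (diagonalSystem φ hmono hlam b).ground) :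
    ControllableToGroundState φ lam B T u₀ := by
  obtain ⟨p, hp, z, hz, hzT⟩ := h
  choose J hJ using exists_isLift_right (φ := φ) hlam
  -- The frame factor is a scalar and the source is linear in the state, so the control is the same
  -- in both frames.
  set y : ℝ → X := fun t => Real.exp (-(lam 0) * t) • z t with hy
  have hyc : ContinuousOn y (Icc 0 T) := by
    have h1 : ContinuousOn (fun t : ℝ => Real.exp (-(lam 0) * t)) (Icc 0 T) := by fun_prop
    exact h1.smul hz.continuousOn
  have hsrc : (fun s => p s • applyOp B (J (y s))) = fun s => p s • b (y s) := by
    funext s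
    rw [hb _ _ (hJ (y s))]
  have hint : IntegrableOn (fun s => p s • b (y s)) (Ioc 0 T) :=
    DiagonalSystem.integrableOn_of_memLp_two
      (DiagonalSystem.memLp_source (D := diagonalSystem φ hmono hlam b) hp hyc)
  refine ⟨p, hp, fun t => J (y t), ⟨fun t _ => (hJ _).mem_fracDomain hlam, fun t ht => ?_,
    fun t ht => ?_⟩, ?_⟩
  · have h1 : ∀ s, fracNorm φ lam (1 / 2) (J (y s) - J (y t)) = ‖y s - y t‖ := fun s =>
      ((hJ _).sub (hJ _)).fracNorm_eq hlam
    simp only [h1]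
    exact tendsto_iff_norm_sub_tendsto_zero.mp (hyc t ht).tendsto
  · refine ext_coord φ fun k => ?_
    have hfun : ∀ s, p s • applyOp B (J (y s)) = p s • b (y s) := fun s => congrFun hsrc s
    simp only [hfun]
    rw [coord_mild hlam ht.1 (hint.mono_set (Ioc_subset_Ioc_right ht.2))]
    have hw : 0 < √(1 + lam k) := Real.sqrt_pos.mpr (by linarith [hlam k])
    refine mul_left_cancel₀ hw.ne' ?_
    rw [← hJ (y t) k]
    have h1 := hz.coord t ht k
    rw [diagonalSystem_w] at h1
    simp only [diagonalSystem_φ, diagonalSystem_μ, diagonalSystem_b] at h1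
    have h2 := exp_mul_duhamel (-(lam 0)) (lam k - lam 0) (fun s => p s * ⟪φ k, b (z s)⟫_ℝ) t
    have h3 : (fun s => ⟪φ k, p s • b (y s)⟫_ℝ) =
        fun s => Real.exp (-(lam 0) * s) * (p s * ⟪φ k, b (z s)⟫_ℝ) := by
      funext s
      rw [hy]
      simp only
      rw [map_smul, inner_smul_right, inner_smul_right]
      ring
    rw [show lam k - lam 0 - -(lam 0) = lam k by ring] at h2
    rw [h3, ← h2, hy]
    simp only
    rw [inner_smul_right, h1, hu k,
      show -(lam k) * t = -(lam 0) * t + -(lam k - lam 0) * t by ring, Real.exp_add]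
    ring
  · refine (hJ _).left_unique hlam ?_
    rw [hy]
    simp only
    rw [hzT, diagonalSystem_ground]
    exact (isLift_basis φ lam 0).smul _

lemma integral_sq_le_of_eLpNorm_le {p : ℝ → ℝ} {T a : ℝ} (ha : 0 ≤ a)
    (hp : MemLp p 2 (timeMeasure T)) (h : eLpNorm p 2 (timeMeasure T) ≤ ENNReal.ofReal a) :
    ∫ s in Ioc 0 T, p s ^ 2 ≤ a ^ 2 := by
  rw [hp.eLpNorm_eq_integral_rpow_norm two_ne_zero ENNReal.ofNat_ne_top,
    ENNReal.ofReal_le_ofReal_iff ha] at h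
  simp only [ENNReal.toReal_ofNat, Real.rpow_two, Real.norm_eq_abs, sq_abs] at h
  rw [← one_div, ← Real.sqrt_eq_rpow] at h
  exact (Real.sqrt_le_left ha).mp h

/-- A finite control cost, in coordinates. -/
lemma exists_null_control_of_cost [CompleteSpace X] (hlam : ∀ k, 0 ≤ lam k) {τ c : ℝ}
    (hτ : 0 < τ) (hc : 0 < c) (hcost : controlCost φ lam B τ ≤ ENNReal.ofReal c) (v : X) :
    ∃ p : ℝ → ℝ, MemLp p 2 (timeMeasure τ) ∧ ∫ s in Ioc 0 τ, p s ^ 2 ≤ (2 * c * ‖v‖) ^ 2 ∧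
      ∀ k, Real.exp (-(lam k) * τ) * ⟪φ k, v⟫_ℝ =
        duhamel (lam k) (fun s => p s * ⟪φ k, applyOp B (φ 0)⟫_ℝ) τ := by
  rcases eq_or_ne v 0 with rfl | hv
  · exact ⟨fun _ => 0, MemLp.zero, by simp, fun k => by simp [duhamel]⟩
  have hv' : ‖v‖ ≠ 0 := norm_ne_zero_iff.mpr hv
  have h1 : ‖(‖v‖⁻¹ • v)‖ = 1 := by rw [norm_smul, norm_inv, norm_norm, inv_mul_cancel₀ hv']
  have h2 := (le_iSup₂ (f := fun (y₀ : X) (_ : ‖y₀‖ = 1) => ⨅ (p : ℝ → ℝ)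
    (_ : MemLp p 2 (timeMeasure τ)) (_ : linSol φ lam B y₀ p τ = 0),
      eLpNorm p 2 (timeMeasure τ)) (‖v‖⁻¹ • v) h1).trans hcost
  -- The infimum in the cost need not be attained; doubling `c` leaves room for an actual control.
  have h3 : ENNReal.ofReal c < ENNReal.ofReal (2 * c) :=
    (ENNReal.ofReal_lt_ofReal_iff (by linarith)).mpr (by linarith)
  have h4 := h2.trans_lt h3
  simp only [iInf_lt_iff] at h4
  obtain ⟨p, hp, hsol, hpc⟩ := h4
  have hpc' := integral_sq_le_of_eLpNorm_le (by positivity) hp hpc.le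
  refine ⟨fun s => ‖v‖ * p s, hp.const_mul _, ?_, fun k => ?_⟩
  · simp only [mul_pow]
    rw [integral_const_mul]
    calc _ ≤ ‖v‖ ^ 2 * (2 * c) ^ 2 := by gcongr
      _ = _ := by ring
  · have hi : IntegrableOn (fun s => p s • applyOp B (φ 0)) (Ioc 0 τ) :=
      (DiagonalSystem.integrableOn_of_memLp_two hp).smul_const _
    have h5 := coord_mild (φ := φ) hlam hτ.le hi (‖v‖⁻¹ • v) k
    rw [show semigroup φ lam τ (‖v‖⁻¹ • v) - ∫ s in (0 : ℝ)..τ,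
      semigroup φ lam (τ - s) (p s • applyOp B (φ 0)) = 0 from hsol, inner_zero_right] at h5
    simp only [inner_smul_right, mul_assoc, duhamel_const_mul] at h5 ⊢
    have h6 := sub_eq_zero.mp h5.symm
    rw [← h6, mul_left_comm, ← mul_assoc ‖v‖, mul_inv_cancel₀ hv', one_mul]

end Transfer

end ParabolicControl

/-! ### Large data: free decay, the climb along the ground state, and the choice of `r₁`. -/

namespace ParabolicControl

namespace DiagonalSystem

variable {X : Type*} [NormedAddCommGroup X] [InnerProductSpace ℝ X] {D : DiagonalSystem X} {δ : ℝ}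

lemma reach_smul_ground (hloc : ∀ v : X, ‖v‖ ≤ δ → D.Reach 1 (D.ground + v) D.ground) {a : ℝ}
    (ha : 0 < a) {x : X} (hx : ‖x - a • D.ground‖ ≤ δ * a) : D.Reach 1 x (a • D.ground) := by
  have h := (hloc (a⁻¹ • (x - a • D.ground)) ?_).smul a
  · rwa [smul_add, smul_inv_smul₀ ha.ne', add_sub_cancel] at h
  · rw [norm_smul, norm_inv, Real.norm_of_nonneg ha.le, inv_mul_le_iff₀ ha]
    linarith

/-- By homogeneity the local radius around `a' • D.ground` is `δ * a'`, so each unit of time permits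
growth by a factor `1 + ε`. -/
lemma reach_chain (hloc : ∀ v : X, ‖v‖ ≤ δ → D.Reach 1 (D.ground + v) D.ground) {ε : ℝ}
    (hε : 0 ≤ ε) (hεδ : ε * ‖D.ground‖ ≤ δ) (n : ℕ) {a a' : ℝ} (ha : 0 < a) (haa : a ≤ a')
    (han : a' ≤ (1 + ε) ^ n * a) : D.Reach n (a • D.ground) (a' • D.ground) := by
  induction n generalizing a' with
  | zero =>
    have h : a = a' := le_antisymm haa (by simpa using han)
    rw [← h, Nat.cast_zero]
    exact (reach_ground le_rfl D).smul a
  | succ n ih =>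
    have h1 : 0 < 1 + ε := by linarith
    -- The maximum keeps the intermediate multiple above `a`, as the induction requires.
    set a'' := max a (a' / (1 + ε)) with ha''
    have h2 : D.Reach n (a • D.ground) (a'' • D.ground) := by
      refine ih (le_max_left _ _) (max_le ?_ ?_)
      · exact le_mul_of_one_le_left ha.le (one_le_pow₀ (by linarith))
      · rw [div_le_iff₀ h1]
        calc a' ≤ _ := han
          _ = _ := by ring
    have h3 : a'' ≤ a' := max_le haa (div_le_self (ha.le.trans haa) (by linarith))
    have h4 : a' ≤ (1 + ε) * a'' := by
      rw [← div_le_iff₀' h1]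
      exact le_max_right _ _
    have h5 : D.Reach 1 (a'' • D.ground) (a' • D.ground) := by
      refine reach_smul_ground hloc (ha.trans_le haa) ?_
      rw [← sub_smul, norm_smul, Real.norm_eq_abs, abs_sub_comm, abs_of_nonneg (by linarith)]
      calc (a' - a'') * ‖D.ground‖ ≤ (ε * a') * ‖D.ground‖ := by
            gcongr
            nlinarith
        _ = ε * ‖D.ground‖ * a' := by ring
        _ ≤ δ * a' := by
          gcongr
          exact ha.le.trans haa
    rw [Nat.cast_succ]
    exact h2.trans n.cast_nonneg zero_le_one h5

variable (D) in
/-- Without control, the state approaches its component along the ground state. -/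
lemma exists_reach_near_ground (hμ : ∀ k, k ≠ 0 → D.μ 1 ≤ D.μ k) {T : ℝ} (hT : 0 ≤ T) (a : ℝ)
    (x : X) : ∃ y, D.Reach T x y ∧ ‖y - a • D.ground‖ ≤ |⟪D.φ 0, x⟫_ℝ - a * √D.c| +
      Real.exp (-(D.μ 1) * T) * ‖x - ⟪D.φ 0, x⟫_ℝ • D.φ 0‖ := by
  obtain ⟨y, hy, -⟩ := D.exists_flow x hT
  refine ⟨y, reach_of_free hT hy, ?_⟩
  have h1 : ‖y - ⟪D.φ 0, x⟫_ℝ • D.φ 0‖ ≤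
      ‖Real.exp (-(D.μ 1) * T) • (x - ⟪D.φ 0, x⟫_ℝ • D.φ 0)‖ := by
    refine norm_le_of_abs_coord_le D.φ fun k => ?_
    rw [inner_sub_right, inner_smul_right, inner_smul_right, inner_sub_right, inner_smul_right,
      hy k, coord_basis]
    split_ifs with hk
    · rw [hk, D.μ_zero]
      simp
    · simp only [mul_zero, sub_zero, abs_mul, abs_of_pos (Real.exp_pos _)]
      gcongr
      exact hμ k hk
  rw [norm_smul, Real.norm_of_nonneg (Real.exp_pos _).le] at h1
  have h2 : y - a • D.ground =
      (⟪D.φ 0, x⟫_ℝ - a * √D.c) • D.φ 0 + (y - ⟪D.φ 0, x⟫_ℝ • D.φ 0) := by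
    rw [ground]
    module
  rw [h2]
  refine (norm_add_le _ _).trans (add_le_add ?_ h1)
  rw [norm_smul, D.φ.orthonormal.1 0, mul_one, Real.norm_eq_abs]

end DiagonalSystem

section Main

variable {X : Type*} [NormedAddCommGroup X] [InnerProductSpace ℝ X] [CompleteSpace X]
  {φ : HilbertBasis ℕ ℝ X} {lam : ℕ → ℝ} {B : X →ₗ.[ℝ] X}

/-- A scalar control cannot steer a two-dimensional eigenspace, so null controllability forces
the first eigenvalue to be simple. -/
lemma ne_of_controlCost_le (hlam : ∀ k, 0 ≤ lam k) {τ c : ℝ} (hτ : 0 < τ) (hc : 0 < c)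
    (hcost : controlCost φ lam B τ ≤ ENNReal.ofReal c) : lam 0 ≠ lam 1 := by
  intro heq
  -- All coordinates with rate `lam 0` see the same scalar integral `I`, so they can only be
  -- proportional to those of `B φ₁`.
  have key : ∀ v : X, ∃ I : ℝ, ∀ k, lam k = lam 0 → Real.exp (-(lam 0) * τ) * ⟪φ k, v⟫_ℝ =
      ⟪φ k, applyOp B (φ 0)⟫_ℝ * I := by
    intro v
    obtain ⟨p, -, -, hp⟩ := exists_null_control_of_cost hlam hτ hc hcost v
    refine ⟨duhamel (lam 0) p τ, fun k hk => ?_⟩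
    rw [← hk, hp k, ← duhamel_const_mul]
    simp only [mul_comm]
  have hpos := (Real.exp_pos (-(lam 0) * τ)).ne'
  obtain ⟨I, hI⟩ := key (φ 0)
  obtain ⟨I', hI'⟩ := key (φ 1)
  have h0 := hI 0 rfl
  have h1 := hI 1 heq.symm
  have h1' := hI' 1 heq.symm
  simp only [coord_basis, if_true, if_false, one_ne_zero, mul_one, mul_zero] at h0 h1 h1'
  rcases mul_eq_zero.mp h1.symm with h | h
  · rw [h, zero_mul] at h1'
    exact hpos h1'
  · rw [h, mul_zero] at h0
    exact hpos h0

/-- In the moving frame the control is multiplied by `e^{λ₁s}`, at most `e^{λ₁}` since `s ≤ 1`; the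
2 pays for a nearly optimal control. Data of the diagonal system are lifted by `(I + A)^{-1/2}`, a
contraction, so the cost bound in `X` suffices. -/
lemma diagonalSystem_nullControllable (hmono : Monotone lam) (hlam : ∀ k, 0 ≤ lam k)
    {b : X →L[ℝ] X} (hb : ∀ x y, IsLift φ lam x y → b y = applyOp B x) {ν T₀ θ : ℝ}
    (hθ1 : θ ≤ 1) (hθ : θ ≤ T₀)
    (hcost : ∀ τ : ℝ, 0 < τ → τ ≤ T₀ →
      controlCost φ lam B τ ≤ ENNReal.ofReal (Real.exp (ν / τ))) :
    (diagonalSystem φ hmono hlam b).NullControllable (2 * Real.exp (lam 0)) ν θ := by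
  intro τ hτ hτθ v
  obtain ⟨y, hy⟩ := exists_isLift_right (φ := φ) hlam v
  obtain ⟨q, hq, hqy, hqk⟩ := exists_null_control_of_cost hlam hτ (Real.exp_pos _)
    (hcost τ hτ (hτθ.trans hθ)) y
  have hle : ∀ s ∈ Ioc 0 τ, lam 0 * s ≤ lam 0 := by
    intro s hs
    exact mul_le_of_le_one_right (hlam 0) (hs.2.trans (hτθ.trans hθ1))
  have hp : MemLp (fun s => Real.exp (lam 0 * s) * q s) 2 (timeMeasure τ) := by
    refine MemLp.of_le_mul (c := Real.exp (lam 0)) hq ?_ ?_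
    · exact (Continuous.aestronglyMeasurable (by fun_prop)).mul hq.1
    · refine (ae_restrict_iff' measurableSet_Ioc).mpr (ae_of_all _ fun s hs => ?_)
      rw [norm_mul, Real.norm_of_nonneg (Real.exp_pos _).le]
      gcongr
      exact hle s hs
  refine ⟨_, hp, ?_, fun k => ?_⟩
  · calc ∫ s in Ioc 0 τ, (Real.exp (lam 0 * s) * q s) ^ 2
        ≤ ∫ s in Ioc 0 τ, Real.exp (lam 0) ^ 2 * q s ^ 2 := by
          refine setIntegral_mono_on hp.integrable_sq (hq.integrable_sq.const_mul _)
            measurableSet_Ioc fun s hs => ?_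
          rw [mul_pow]
          gcongr
          exact hle s hs
      _ = Real.exp (lam 0) ^ 2 * ∫ s in Ioc 0 τ, q s ^ 2 := integral_const_mul _ _
      _ ≤ Real.exp (lam 0) ^ 2 * (2 * Real.exp (ν / τ) * ‖y‖) ^ 2 := by gcongr
      _ ≤ Real.exp (lam 0) ^ 2 * (2 * Real.exp (ν / τ) * ‖v‖) ^ 2 := by
        gcongr
        exact hy.norm_le hlam
      _ = _ := by ring
  · rw [diagonalSystem_w]
    simp only [diagonalSystem_φ, diagonalSystem_μ, diagonalSystem_b, diagonalSystem_ground]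
    rw [hb _ _ (isLift_basis φ lam 0), hy k]
    have h1 := exp_mul_duhamel (lam 0) (lam k)
      (fun s => q s * ⟪φ k, applyOp B (φ 0)⟫_ℝ) τ
    simp only [← mul_assoc] at h1
    rw [← h1, ← hqk k,
      show -(lam k - lam 0) * τ = lam 0 * τ + -(lam k) * τ by ring, Real.exp_add]
    ring

/-- Since `log(R²/r²) = 2 log(R/r)`, the decay factor is `(r/R)^{2m/κ} ≤ r/R` when `R ≥ r`; for `R ≤
r` no decay is needed. -/
lemma exp_neg_mul_log_le {m κ r R : ℝ} (hκ : 0 < κ) (hκm : κ ≤ 2 * m) (hr : 0 < r) (hR : 0 < R) :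
    Real.exp (-m * (κ⁻¹ * max 0 (Real.log (R ^ 2 / r ^ 2)))) * R ≤ r := by
  rw [← div_pow, Real.log_pow]
  rcases le_total R r with h | h
  · have h1 : Real.exp (-m * (κ⁻¹ * max 0 ((2 : ℕ) * Real.log (R / r)))) ≤ 1 := by
      rw [Real.exp_le_one_iff]
      have h2 : 0 ≤ κ⁻¹ * max 0 ((2 : ℕ) * Real.log (R / r)) :=
        mul_nonneg (inv_nonneg.mpr hκ.le) (le_max_left _ _)
      nlinarith
    calc _ ≤ 1 * R := by gcongr
      _ ≤ r := by linarith
  · have hlog : 0 ≤ Real.log (R / r) := Real.log_nonneg ((one_le_div hr).mpr h)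
    rw [max_eq_right (by positivity)]
    have h1 : Real.log (R / r) ≤ m * (κ⁻¹ * ((2 : ℕ) * Real.log (R / r))) := by
      have h2 : 1 ≤ 2 * m * κ⁻¹ := by
        rw [← div_eq_mul_inv]
        exact (one_le_div hκ).mpr hκm
      calc _ ≤ 2 * m * κ⁻¹ * Real.log (R / r) := le_mul_of_one_le_left hlog h2
        _ = _ := by
          push_cast
          ring
    calc _ ≤ Real.exp (-(Real.log (R / r))) * R := by
          gcongr
          linarith
      _ = r := by
        rw [Real.exp_neg, Real.exp_log (by positivity)]
        field_simp

lemma natCast_le_inv_mul_log {κ r R R₀ : ℝ} (n : ℕ) (hκ : 0 < κ) (hr : 0 < r)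
    (hrR : r ≤ R₀ * Real.exp (-(κ * n / 2))) (hR : R₀ ≤ R) :
    (n : ℝ) ≤ κ⁻¹ * max 0 (Real.log (R ^ 2 / r ^ 2)) := by
  rw [← div_eq_inv_mul, le_div_iff₀ hκ]
  refine le_max_of_le_right ?_
  have h1 : r * Real.exp (κ * n / 2) ≤ R := by
    calc _ ≤ R₀ * Real.exp (-(κ * n / 2)) * Real.exp (κ * n / 2) := by gcongr
      _ = R₀ := by rw [mul_assoc, ← Real.exp_add, neg_add_cancel, Real.exp_zero, mul_one]
      _ ≤ R := hR
  have hR0 : 0 < R := lt_of_lt_of_le (by positivity) h1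
  rw [← div_pow, Real.log_pow]
  have h2 : κ * n / 2 ≤ Real.log (R / r) := by
    rw [Real.le_log_iff_exp_le (by positivity), le_div_iff₀ hr]
    linarith
  push_cast
  linarith

end Main

end ParabolicControl

open ParabolicControl

theorem mainTheorem2 {X : Type*} [NormedAddCommGroup X] [InnerProductSpace ℝ X]
    [CompleteSpace X] [TopologicalSpace.SeparableSpace X]
    (A : X →ₗ.[ℝ] X) (hA : ParabolicControl.IsAdmissible A)
    (φ : HilbertBasis ℕ ℝ X) (lam : ℕ → ℝ) (hφ : ParabolicControl.IsEigenbasis A φ lam)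
    (B : X →ₗ.[ℝ] X) (hB : ParabolicControl.HalfBounded φ lam B)
    (hnull : ∀ T : ℝ, 0 < T → ParabolicControl.OneNullControllable φ lam B T)
    (hcost : ∃ ν : ℝ, 0 < ν ∧ ∃ T₀ : ℝ, 0 < T₀ ∧ ∀ τ : ℝ, 0 < τ → τ ≤ T₀ →
      ParabolicControl.controlCost φ lam B τ ≤ ENNReal.ofReal (Real.exp (ν / τ))) :
    ∃ r₁ : ℝ, 0 < r₁ ∧ ∀ R : ℝ, 0 < R → ∃ T_R : ℝ, 0 < T_R ∧
      T_R = 1 + (min (lam 1) (2 * (lam 1 - lam 0)))⁻¹ * max 0 (Real.log (R ^ 2 / r₁ ^ 2)) ∧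
      ∀ u₀ ∈ ParabolicControl.fracDomain φ lam (1 / 2),
        |ParabolicControl.fracInner φ lam (1 / 2) u₀ (φ 0) - 1| < r₁ →
        ParabolicControl.fracNorm φ lam (1 / 2)
          (u₀ - ParabolicControl.fracInner φ lam (1 / 2) u₀ (φ 0) • φ 0) ≤ R →
        ParabolicControl.ControllableToGroundState φ lam B T_R u₀ := by
  obtain ⟨ν, hν, T₀, hT₀, hcost⟩ := hcost
  have hmono := hφ.mono
  have hlam : ∀ k, 0 ≤ lam k := hφ.nonneg hA
  have hgap : lam 0 < lam 1 := lt_of_le_of_ne (hmono zero_le_one)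
    (ne_of_controlCost_le hlam hT₀ (Real.exp_pos _) (hcost T₀ hT₀ le_rfl))
  obtain ⟨b, hb⟩ := exists_lifted_operator hlam hB
  set D := diagonalSystem φ hmono hlam b with hD
  have hN := diagonalSystem_nullControllable hmono hlam hb (min_le_left 1 T₀) (min_le_right 1 T₀)
    hcost
  obtain ⟨δ, hδ, hloc⟩ := DiagonalSystem.exists_reach_ground (by positivity) hν.le
    (lt_min one_pos hT₀) (min_le_left 1 T₀) hN
  rw [← hD] at hloc
  set κ := min (lam 1) (2 * (lam 1 - lam 0)) with hκdef
  have hκ : 0 < κ := lt_min ((hlam 0).trans_lt hgap) (by linarith)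
  have hκm : κ ≤ 2 * (lam 1 - lam 0) := min_le_right _ _
  have hl0 := hlam 0
  set c := 1 + lam 0 with hc
  have hc1 : 1 ≤ c := by linarith
  have hc0 : 0 < c := by linarith
  set s := √c with hs
  have hs1 : 1 ≤ s := Real.one_le_sqrt.mpr hc1
  have hss : s * s = c := Real.mul_self_sqrt hc0.le
  set ε := δ / (‖D.ground‖ + 1) with hε
  have hε0 : 0 < ε := by positivity
  have hεδ : ε * ‖D.ground‖ ≤ δ := by
    rw [hε, div_mul_eq_mul_div, div_le_iff₀ (by positivity)]
    nlinarith [norm_nonneg D.ground]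
  -- `n` is the number of unit-time steps from `c⁻¹` to `1`; none is needed when `lam 0 = 0`, and
  -- then `R` has no lower bound to provide the time.
  obtain ⟨n, hn, hn0⟩ : ∃ n : ℕ, c ≤ (1 + ε) ^ n ∧ (lam 0 = 0 → n = 0) := by
    rcases hl0.eq_or_lt with h | h
    · exact ⟨0, by simp [hc, ← h], fun _ => rfl⟩
    · obtain ⟨n, hn⟩ := pow_unbounded_of_one_lt c (by linarith : 1 < 1 + ε)
      exact ⟨n, hn.le, fun h' => absurd h' h.ne'⟩
  set E := Real.exp ((lam 1 - lam 0) * n) with hE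
  have hE0 : 0 < E := Real.exp_pos _
  obtain ⟨R₀, hR₀, hR₀l⟩ : ∃ R₀ : ℝ, 0 < R₀ ∧ (lam 0 ≠ 0 → R₀ = lam 0 / (2 * s)) := by
    by_cases h : lam 0 = 0
    · exact ⟨1, one_pos, fun h' => absurd h h'⟩
    · exact ⟨lam 0 / (2 * s), by have := hl0.lt_of_ne' h; positivity, fun _ => rfl⟩
  -- The three bounds give, in order: `c * a ≥ 1 / 2`; entry into the local ball around `c⁻¹ •
  -- D.ground`, where `E` pays for the `n` units taken from the decay time; and enough total time
  -- for `n` steps.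
  set r₁ := min (1 / 2) (min (δ / (c * (1 + E))) (R₀ * Real.exp (-(κ * n / 2)))) with hr₁def
  have hr₁ : 0 < r₁ := lt_min (by norm_num) (lt_min (by positivity) (by positivity))
  have hr₁a : r₁ ≤ 1 / 2 := min_le_left _ _
  have hr₁b : r₁ ≤ δ / (c * (1 + E)) := (min_le_right _ _).trans (min_le_left _ _)
  have hr₁c : r₁ ≤ R₀ * Real.exp (-(κ * n / 2)) := (min_le_right _ _).trans (min_le_right _ _)
  refine ⟨r₁, hr₁, fun R hR => ⟨_, ?_, rfl, fun u₀ hu₀ hu₁ hu₂ => ?_⟩⟩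
  · have h1 : 0 ≤ κ⁻¹ * max 0 (Real.log (R ^ 2 / r₁ ^ 2)) :=
      mul_nonneg (inv_nonneg.mpr hκ.le) (le_max_left _ _)
    linarith
  obtain ⟨z₀, hz₀⟩ := exists_isLift hlam hu₀
  rw [fracInner_basis hlam hu₀] at hu₁ hu₂
  set a := ⟪φ 0, u₀⟫_ℝ with ha
  have hz₀a : ⟪φ 0, z₀⟫_ℝ = s * a := hz₀ 0
  have hlift := hz₀.sub ((isLift_basis φ lam 0).smul (c * a))
  rw [hlift.fracNorm_eq hlam, ← hs] at hu₂
  -- As `φ 0` has squared energy norm `c`, the subtraction in the hypothesis overshoots and leaves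
  -- `-lam 0 * (s * a)` along `φ 0`. This residue bounds `R` from below by `R₀` when `lam 0 > 0`.
  have hcoord : ∀ k, ⟪φ k, z₀ - (c * a) • s • φ 0⟫_ℝ =
      if k = 0 then -(lam 0 * (s * a)) else ⟪φ k, z₀⟫_ℝ := by
    intro k
    rw [inner_sub_right, inner_smul_right, inner_smul_right, coord_basis]
    split_ifs with h
    · rw [h, hz₀a, hc]
      ring
    · simp
  have hrest : ‖z₀ - ⟪φ 0, z₀⟫_ℝ • φ 0‖ ≤ R := by
    refine le_trans (norm_le_of_abs_coord_le φ fun k => ?_) hu₂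
    rw [hcoord k, inner_sub_right, inner_smul_right, coord_basis]
    split_ifs with h
    · rw [h, mul_one, sub_self, abs_zero]
      exact abs_nonneg _
    · simp
  have hlen : (n : ℝ) ≤ κ⁻¹ * max 0 (Real.log (R ^ 2 / r₁ ^ 2)) := by
    by_cases h : lam 0 = 0
    · rw [hn0 h, Nat.cast_zero]
      exact mul_nonneg (inv_nonneg.mpr hκ.le) (le_max_left _ _)
    · refine natCast_le_inv_mul_log n hκ hr₁ hr₁c ?_
      have h1 : |⟪φ 0, z₀ - (c * a) • s • φ 0⟫_ℝ| ≤ R := by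
        refine (abs_real_inner_le_norm _ _).trans ?_
        rw [φ.orthonormal.1 0, one_mul]
        exact hu₂
      rw [hcoord 0, if_pos rfl, abs_neg] at h1
      have h2 : 1 / 2 ≤ c * a := by linarith [(abs_lt.mp hu₁).1]
      have h3 : 1 / (2 * s) ≤ s * a := by
        rw [div_le_iff₀ (by positivity)]
        calc (1 : ℝ) ≤ 2 * (c * a) := by linarith
          _ = s * a * (2 * s) := by
            rw [← hss]
            ring
      rw [hR₀l h]
      calc lam 0 / (2 * s) = lam 0 * (1 / (2 * s)) := by ring
        _ ≤ lam 0 * (s * a) := by gcongr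
        _ ≤ R := (le_abs_self _).trans h1
  set L := κ⁻¹ * max 0 (Real.log (R ^ 2 / r₁ ^ 2)) with hL
  have hμ : ∀ k, k ≠ 0 → D.μ 1 ≤ D.μ k := fun k hk =>
    sub_le_sub_right (hmono (Nat.one_le_iff_ne_zero.mpr hk)) _
  obtain ⟨y, hy, hynear⟩ := D.exists_reach_near_ground hμ (sub_nonneg.mpr hlen) c⁻¹ z₀
  have hdecay : Real.exp (-(lam 1 - lam 0) * (L - n)) * R ≤ E * r₁ := by
    have h1 := exp_neg_mul_log_le hκ hκm hr₁ hR
    rw [← hL] at h1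
    calc _ = E * (Real.exp (-(lam 1 - lam 0) * L) * R) := by
          rw [hE, ← mul_assoc, ← Real.exp_add]
          ring_nf
      _ ≤ _ := by gcongr
  have hmain : |⟪φ 0, z₀⟫_ℝ - c⁻¹ * s| ≤ r₁ := by
    have h1 : ⟪φ 0, z₀⟫_ℝ - c⁻¹ * s = s / c * (c * a - 1) := by
      rw [hz₀a]
      field_simp
    have h2 : s / c ≤ 1 := by
      rw [div_le_one hc0, ← hss]
      exact le_mul_of_one_le_left (by linarith) hs1
    rw [h1, abs_mul, abs_of_nonneg (by positivity)]
    calc _ ≤ 1 * |c * a - 1| := by gcongr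
      _ ≤ r₁ := by linarith
  have hnear : ‖y - c⁻¹ • D.ground‖ ≤ δ * c⁻¹ := by
    calc _ ≤ _ := hynear
      _ ≤ r₁ + Real.exp (-(lam 1 - lam 0) * (L - n)) * R := add_le_add hmain (by
          refine mul_le_mul_of_nonneg_left hrest (Real.exp_pos _).le)
      _ ≤ r₁ + E * r₁ := by gcongr
      _ = (1 + E) * r₁ := by ring
      _ ≤ (1 + E) * (δ / (c * (1 + E))) := by gcongr
      _ = δ * c⁻¹ := by field_simp
  -- The total time is `(L - n) + 1 + n`: free decay, local control to `c⁻¹ • D.ground`, then the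
  -- climb to `D.ground`.
  have h1 := hy.trans (sub_nonneg.mpr hlen) zero_le_one
    (DiagonalSystem.reach_smul_ground hloc (inv_pos.mpr hc0) hnear)
  have h2 := h1.trans (by linarith) n.cast_nonneg
    (DiagonalSystem.reach_chain hloc hε0.le hεδ n (a' := 1) (inv_pos.mpr hc0)
      (inv_le_one_of_one_le₀ hc1) (by rwa [← div_eq_mul_inv, one_le_div hc0]))
  rw [one_smul, show L - n + 1 + n = 1 + L by ring] at h2
  exact controllableToGroundState_of_reach hmono hlam hb hz₀ h2
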